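/- A compact weighted rooted real tree is a quadruple $(T,\varnothing,d,\mu)$ where $(T,d)$ is a compact real tree (a metric space in which any two points $x,y$ are joined by a unique isometric map $f_{x,y}:[0,d(x,y)]\to T$ with $f_{x,y}(0)=x$, $f_{x,y}(d(x,y))=y$, and in which every injective continuous path $[0,1]\to T$ from $x$ to $y$ has range $[\![x,y]\!]:=f_{x,y}([0,d(x,y)])$), $\varnothing\in T$ is the root and $\mu$ is a finite nonnegative Borel measure on $T$. Let $\mathbb T$ be the set of measure-preserving and root-preserving isometry classes of such trees, with the Gromov–Hausdorff–Prokhorov topology, induced by the distance $$d_{\mathrm{GHP}}(T,T')=\inf_{\mathcal R,m}\ \tfrac12\operatorname{dis}(\mathcal R)\ \vee\ \bigl(d_{\mathrm{TV}}(m\circ p^{-1},\mu)+d_{\mathrm{TV}}(m\circ p'^{-1},\mu')\bigr)\ \vee\ m(\mathcal R^c),$$ where $\mathcal R\subset T\times T'$ ranges over the correspondences with $(\varnothing,\varnothing')\in\mathcal R$ (subsets whose two projections are onto), $m$ over the finite nonnegative measures on $T\times T'$, $p,p'$ are the coordinate projections, $\operatorname{dis}(\mathcal R)=\sup\{|d(x,y)-d'(x',y')|:(x,x'),(y,y')\in\mathcal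 R\}$ and $d_{\mathrm{TV}}(\mu,\nu)=\frac12\sup\{|\mu(f)-\nu(f)|: f\text{ measurable},\ |f|\le1\}$. Equip $\mathbb T$ with its Borel $\sigma$-field. For $x\in T$ write $H(x)=d(\varnothing,x)$, and for $0\le r\le H(x)$ let $x_r$ be the point of $[\![\varnothing,x]\!]$ at distance $r$ from $\varnothing$, and let $T_{r,x}=\{y\in T: x_r\in[\![\varnothing,y]\!]\}$, viewed as a compact weighted rooted real tree with root $x_r$ and the restrictions of $d$ and $\mu$. **Theorem.** For every compact weighted rooted real tree $T$, the map $(r,x)\mapsto T_{r,x}$ from $\{(r,x)\in\mathbb R_+\times T: r\le H(x)\}$ to $\mathbb T$ is Borel measurable, and the formula $$\Psi_T(f)=\int_T\mu(dx)\int_0^{H(x)}f(T_{r,x},r)\,dr,\qquad f:\mathbb T\times\mathbb R_+\to[0,\infty]\ \text{measurable},$$ defines a finite measure $\Psi_T$ on $\mathbb T\times\mathbb R_+$ that depends only on the class of $T$ in $\mathbb T$. The map $T\mapsto\Psi_T$, from $\mathbb T$ with the Gromov–Hausdorff–Prokhorov topology to the space $\mathcal M(\mathbb T\times\mathbb R_+)$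 of finite nonnegative measures on $\mathbb T\times\mathbb R_+$ with the topology of weak convergence, is continuous. -/

import Mathlib

open MeasureTheory
open scoped NNReal ENNReal

namespace RealTrees

noncomputable section

/-! ### Real trees -/

section Geodesics

variable {X : Type*} [MetricSpace X]

/-- `f : [0, d(x,y)] → X` is an isometric map with `f 0 = x` and `f (d(x,y)) = y`. -/
structure IsGeodesic (x y : X) (f : Set.Icc (0 : ℝ) (dist x y) → X) : Prop where
  isometry : Isometry f
  left : f ⟨0, le_rfl, dist_nonneg⟩ = x
  right : f ⟨dist x y, dist_nonneg, le_rfl⟩ = y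

/-- The line segment `⟦x, y⟧`: the range of the isometric map `[0, d(x,y)] → X` from `x` to `y`
(which is unique in a real tree). -/
def seg (x y : X) : Set X :=
  {z | ∃ f : Set.Icc (0 : ℝ) (dist x y) → X, IsGeodesic x y f ∧ z ∈ Set.range f}

end Geodesics

/-- Real trees: (i) unique geodesics, (ii) every injective continuous path from `x` to `y`
has the same range as the geodesic from `x` to `y`. -/
structure IsRealTree (X : Type*) [MetricSpace X] : Prop where
  existsUnique_geodesic : ∀ x y : X, ∃! f : Set.Icc (0 : ℝ) (dist x y) → X, IsGeodesic x y f
  loop_free : ∀ (x y : X) (φ : Set.Icc (0 : ℝ) 1 → X), Continuous φ → Function.Injective φ →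
    φ 0 = x → φ 1 = y → Set.range φ = seg x y

namespace IsRealTree

variable {X : Type*} [MetricSpace X]

/-- The geodesic from `x` to `y` as a function on `ℝ`, with the properties used below. -/
theorem exists_path (h : IsRealTree X) (x y : X) : ∃ g : ℝ → X, Continuous g ∧ g 0 = x ∧
    g (dist x y) = y ∧
    (∀ s ∈ Set.Icc 0 (dist x y), ∀ t ∈ Set.Icc 0 (dist x y), dist (g s) (g t) = |s - t|) ∧
    ∀ z, z ∈ seg x y ↔ ∃ s ∈ Set.Icc 0 (dist x y), g s = z := by
  obtain ⟨f, hf, hu⟩ := h.existsUnique_geodesic x y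
  have hE : ∀ s (hs : s ∈ Set.Icc 0 (dist x y)),
      Set.IccExtend (dist_nonneg (x := x) (y := y)) f s = f ⟨s, hs⟩ :=
    fun s hs => Set.IccExtend_of_mem _ f hs
  refine ⟨Set.IccExtend dist_nonneg f, hf.isometry.continuous.Icc_extend', ?_, ?_, ?_, ?_⟩
  · rw [hE 0 ⟨le_rfl, dist_nonneg⟩, hf.left]
  · rw [hE _ ⟨dist_nonneg, le_rfl⟩, hf.right]
  · intro s hs t ht
    rw [hE s hs, hE t ht, hf.isometry.dist_eq]
    rfl
  · intro z
    constructor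
    · rintro ⟨f', hf', ⟨⟨s, hs⟩, rfl⟩⟩
      exact ⟨s, hs, by rw [hE s hs, hu f' hf']⟩
    · rintro ⟨s, hs, rfl⟩
      exact ⟨f, hf, ⟨s, hs⟩, (hE s hs).symm⟩

theorem mem_seg_iff (h : IsRealTree X) {x y z : X} :
    z ∈ seg x y ↔ dist x z + dist z y = dist x y := by
  constructor
  · intro hz
    obtain ⟨g, -, h0, h1, hd, hr⟩ := h.exists_path x y
    obtain ⟨s, hs, rfl⟩ := (hr z).1 hz
    have e1 := hd 0 ⟨le_rfl, dist_nonneg⟩ s hs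
    have e2 := hd s hs _ ⟨dist_nonneg, le_rfl⟩
    rw [h0, abs_sub_comm, sub_zero, abs_of_nonneg hs.1] at e1
    rw [h1, abs_sub_comm, abs_of_nonneg (sub_nonneg.2 hs.2)] at e2
    linarith
  · intro hz
    obtain ⟨g, -, g0, g1, gd, -⟩ := h.exists_path x z
    obtain ⟨k, -, k0, k1, kd, -⟩ := h.exists_path z y
    have hxz : (0 : ℝ) ≤ dist x z := dist_nonneg
    have hzy : (0 : ℝ) ≤ dist z y := dist_nonneg
    let p : ℝ → X := fun s => if s ≤ dist x z then g s else k (s - dist x z)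
    have key : ∀ s t : ℝ, 0 ≤ s → s ≤ t → t ≤ dist x y → dist (p s) (p t) = t - s := by
      intro s t hs hst ht
      by_cases h1 : t ≤ dist x z
      · have h2 : s ≤ dist x z := hst.trans h1
        simp only [p, h1, h2, if_true]
        rw [gd s ⟨hs, h2⟩ t ⟨hs.trans hst, h1⟩, abs_sub_comm, abs_of_nonneg (by linarith)]
      · by_cases h2 : s ≤ dist x z
        · simp only [p, h1, h2, if_true, if_false]
          have a1 := gd s ⟨hs, h2⟩ _ ⟨hxz, le_rfl⟩
          have a2 := kd 0 ⟨le_rfl, hzy⟩ (t - dist x z) ⟨by linarith, by linarith⟩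
          have a3 := gd 0 ⟨le_rfl, hxz⟩ s ⟨hs, h2⟩
          have a4 := kd (t - dist x z) ⟨by linarith, by linarith⟩ _ ⟨hzy, le_rfl⟩
          rw [g1, abs_sub_comm, abs_of_nonneg (by linarith)] at a1
          rw [k0, abs_sub_comm, abs_of_nonneg (by linarith)] at a2
          rw [g0, abs_sub_comm, abs_of_nonneg (by linarith)] at a3
          rw [k1, abs_sub_comm, abs_of_nonneg (by linarith)] at a4
          have t1 := dist_triangle (g s) z (k (t - dist x z))
          have t2 := dist_triangle4 x (g s) (k (t - dist x z)) y
          linarith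
        · simp only [p, h1, h2, if_false]
          rw [kd _ ⟨by linarith, by linarith⟩ _ ⟨by linarith, by linarith⟩, abs_sub_comm,
            abs_of_nonneg (by linarith)]
          ring
    refine ⟨fun s => p s, ⟨?_, ?_, ?_⟩, ⟨⟨dist x z, hxz, by linarith⟩, ?_⟩⟩
    · refine Isometry.of_dist_eq ?_
      rintro ⟨s, hs⟩ ⟨t, ht⟩
      rw [Subtype.dist_eq, Real.dist_eq]
      rcases le_total s t with hst | hst
      · rw [key s t hs.1 hst ht.2, abs_sub_comm, abs_of_nonneg (by simpa using hst)]
      · rw [dist_comm, key t s ht.1 hst hs.2, abs_of_nonneg (by simpa using hst)]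
    · simp [p, g0]
    · by_cases hc : dist z y = 0
      · have : z = y := dist_eq_zero.1 hc
        subst this
        simp [p, g1]
      · have : ¬ dist x y ≤ dist x z := by
          intro hle
          exact hc (by linarith)
        have e : dist x y - dist x z = dist z y := by linarith
        simp [p, this, e, k1]
    · simp [p, g1]

/-- In a real tree, `⟦a, b⟧ ⊆ ⟦a, y⟧ ∪ ⟦y, b⟧`. -/
theorem seg_subset_union (h : IsRealTree X) {a b y z : X} (hz : z ∈ seg a b) :
    z ∈ seg a y ∨ z ∈ seg y b := by
  obtain ⟨g, gc, g0, g1, gd, gr⟩ := h.exists_path a y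
  let K : Set ℝ := {t | t ∈ Set.Icc 0 (dist a y) ∧ dist y (g t) + dist (g t) b = dist y b}
  have hKne : K.Nonempty := ⟨dist a y, ⟨dist_nonneg, le_rfl⟩, by rw [g1]; simp⟩
  have hKc : IsClosed K := by
    refine isClosed_Icc.inter (isClosed_eq ?_ continuous_const)
    fun_prop
  have hKb : BddBelow K := ⟨0, fun t ht => ht.1.1⟩
  set t₀ := sInf K with ht₀
  obtain ⟨ht0, hc⟩ : t₀ ∈ K := hKc.csInf_mem hKne hKb
  have hmin : ∀ s, s ∈ K → t₀ ≤ s := fun s hs => csInf_le hKb hs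
  obtain ⟨k, kc, k0, k1, kd, kr⟩ := h.exists_path (g t₀) b
  set E := dist (g t₀) b with hE
  have hE0 : 0 ≤ E := dist_nonneg
  have hkseg : ∀ u ∈ Set.Icc 0 E, dist y (k u) + dist (k u) b = dist y b := by
    intro u hu
    have h1 := h.mem_seg_iff.1 ((kr (k u)).2 ⟨u, hu, rfl⟩)
    have h2 := dist_triangle y (g t₀) (k u)
    have h3 := dist_triangle y (k u) b
    linarith
  let p : ℝ → X := fun s => if s ≤ t₀ then g s else k (s - t₀)
  have pc : Continuous p := by
    refine Continuous.if_le gc (kc.comp (by fun_prop)) continuous_id continuous_const ?_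
    rintro s rfl
    simp [k0]
  have pinj : ∀ s ∈ Set.Icc 0 (t₀ + E), ∀ t ∈ Set.Icc 0 (t₀ + E), s < t → p s ≠ p t := by
    intro s hs t ht hst heq
    by_cases h1 : t ≤ t₀
    · have h2 : s ≤ t₀ := hst.le.trans h1
      simp only [p, h1, h2, if_true] at heq
      have := gd s ⟨hs.1, h2.trans ht0.2⟩ t ⟨ht.1, h1.trans ht0.2⟩
      rw [heq, dist_self] at this
      have := abs_eq_zero.1 this.symm
      linarith
    · by_cases h2 : s ≤ t₀
      · simp only [p, h1, h2, if_true, if_false] at heq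
        have hu : t - t₀ ∈ Set.Icc 0 E := ⟨by linarith, by linarith [ht.2]⟩
        have h3 := hkseg _ hu
        have h4 : t₀ ≤ s := hmin s ⟨⟨hs.1, h2.trans ht0.2⟩, by rw [heq]; exact h3⟩
        have h5 : s = t₀ := le_antisymm h2 h4
        have h6 := kd 0 ⟨le_rfl, hE0⟩ _ hu
        rw [k0, ← heq, h5, dist_self] at h6
        have := abs_eq_zero.1 h6.symm
        linarith
      · simp only [p, h1, h2, if_false] at heq
        have := kd (s - t₀) ⟨by linarith, by linarith [hs.2]⟩ (t - t₀)
          ⟨by linarith, by linarith [ht.2]⟩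
        rw [heq, dist_self] at this
        have := abs_eq_zero.1 this.symm
        linarith
  have hpa : p 0 = a := by simp [p, ht0.1, g0]
  have hpb : p (t₀ + E) = b := by
    by_cases hEz : E = 0
    · have : g t₀ = b := dist_eq_zero.1 hEz
      simp [p, hEz, this]
    · have : ¬ t₀ + E ≤ t₀ := by
        intro hle
        exact hEz (le_antisymm (by linarith) hE0)
      simp [p, this, k1]
  have hpart : ∀ s ∈ Set.Icc 0 (t₀ + E), p s ∈ seg a y ∨ p s ∈ seg y b := by
    intro s hs
    by_cases h1 : s ≤ t₀
    · left
      simp only [p, h1, if_true]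
      exact (gr _).2 ⟨s, ⟨hs.1, h1.trans ht0.2⟩, rfl⟩
    · right
      simp only [p, h1, if_false]
      exact h.mem_seg_iff.2 (hkseg _ ⟨by linarith, by linarith [hs.2]⟩)
  rcases (add_nonneg ht0.1 hE0).eq_or_lt with hL | hL
  · have hab : a = b := by rw [← hpa, ← hpb, ← hL]
    have hz' := h.mem_seg_iff.1 hz
    rw [hab, dist_self] at hz'
    have : z = b := dist_eq_zero.1 (by
      have h1 := dist_nonneg (x := b) (y := z)
      have h2 := dist_nonneg (x := z) (y := b)
      linarith)
    right
    rw [this]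
    exact h.mem_seg_iff.2 (by simp)
  · have hmem : ∀ u : Set.Icc (0 : ℝ) 1, (t₀ + E) * u ∈ Set.Icc 0 (t₀ + E) := fun u =>
      ⟨mul_nonneg hL.le u.2.1, mul_le_of_le_one_right hL.le u.2.2⟩
    have hrange := h.loop_free a b (fun u => p ((t₀ + E) * u)) (pc.comp (by fun_prop)) (by
      intro u v huv
      rcases lt_trichotomy (u : ℝ) v with hlt | heq | hlt
      · exact absurd huv (pinj _ (hmem u) _ (hmem v) (mul_lt_mul_of_pos_left hlt hL))
      · exact Subtype.ext heq
      · exact absurd huv.symm (pinj _ (hmem v) _ (hmem u) (mul_lt_mul_of_pos_left hlt hL)))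
      (by simpa using hpa) (by simpa using hpb)
    rw [← hrange] at hz
    obtain ⟨u, rfl⟩ := hz
    exact hpart _ (hmem u)

/-- A subset that contains the segment between any two of its points is a real tree. -/
theorem subtype (h : IsRealTree X) {S : Set X} (hS : ∀ a ∈ S, ∀ b ∈ S, seg a b ⊆ S) :
    IsRealTree S := by
  have hex : ∀ x y : S, ∃! f : Set.Icc (0 : ℝ) (dist x y) → S, IsGeodesic x y f := by
    intro x y
    obtain ⟨f, hf, hu⟩ := h.existsUnique_geodesic (x : X) y
    refine ⟨fun s => ⟨f s, hS x x.2 y y.2 ⟨f, hf, s, rfl⟩⟩, ⟨?_, ?_, ?_⟩, ?_⟩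
    · exact Isometry.of_dist_eq fun s t => hf.isometry.dist_eq s t
    · exact Subtype.ext hf.left
    · exact Subtype.ext hf.right
    · intro f' hf'
      have := hu (fun s => (f' s : X)) ⟨isometry_subtype_coe.comp hf'.isometry,
        congrArg Subtype.val hf'.left, congrArg Subtype.val hf'.right⟩
      funext s
      exact Subtype.ext (congrFun this s)
  refine ⟨hex, ?_⟩
  intro x y φ hφ hinj h0 h1
  have hrange := h.loop_free (x : X) y (fun u => (φ u : X)) (continuous_subtype_val.comp hφ)
    (Subtype.val_injective.comp hinj) (by rw [h0]) (by rw [h1])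
  have hseg : ∀ z : S, z ∈ seg x y ↔ (z : X) ∈ seg (x : X) y := by
    intro z
    constructor
    · rintro ⟨f, hf, s, rfl⟩
      exact ⟨fun s => (f s : X), ⟨isometry_subtype_coe.comp hf.isometry,
        congrArg Subtype.val hf.left, congrArg Subtype.val hf.right⟩, s, rfl⟩
    · rintro ⟨f, hf, s, hs⟩
      refine ⟨fun s => ⟨f s, hS x x.2 y y.2 ⟨f, hf, s, rfl⟩⟩,
        ⟨Isometry.of_dist_eq fun s t => hf.isometry.dist_eq s t, Subtype.ext hf.left,
          Subtype.ext hf.right⟩, s, Subtype.ext hs⟩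
  ext z
  rw [hseg, ← hrange]
  constructor
  · rintro ⟨u, rfl⟩
    exact ⟨u, rfl⟩
  · rintro ⟨u, hu⟩
    exact ⟨u, Subtype.ext hu⟩

end IsRealTree

/-! ### Compact weighted rooted real trees and their isometry classes -/

/-- A compact rooted real tree endowed with a finite Borel measure. -/
structure WeightedTree : Type 1 where
  carrier : Type
  [metricSpace : MetricSpace carrier]
  [compactSpace : CompactSpace carrier]
  [measurableSpace : MeasurableSpace carrier]
  [borelSpace : BorelSpace carrier]
  isRealTree : IsRealTree carrier
  root : carrier
  μ : Measure carrier
  [isFiniteMeasure : IsFiniteMeasure μ]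

instance : CoeSort WeightedTree Type := ⟨WeightedTree.carrier⟩

attribute [instance] WeightedTree.metricSpace WeightedTree.compactSpace
  WeightedTree.measurableSpace WeightedTree.borelSpace WeightedTree.isFiniteMeasure

/-- Existence of a measure-preserving and root-preserving isometry from `T` onto `T'`. -/
def Equivalent (T T' : WeightedTree) : Prop :=
  ∃ e : T ≃ᵢ T', e T.root = T'.root ∧ T.μ.map e = T'.μ

theorem equivalence_equivalent : Equivalence Equivalent where
  refl T := ⟨IsometryEquiv.refl T, rfl, by
    have : (⇑(IsometryEquiv.refl T) : T → T) = id := rfl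
    rw [this, Measure.map_id]⟩
  symm := by
    rintro T T' ⟨e, h1, h2⟩
    refine ⟨e.symm, by rw [← h1, e.symm_apply_apply], ?_⟩
    rw [← h2, Measure.map_map e.symm.continuous.measurable e.continuous.measurable]
    have : (⇑e.symm ∘ ⇑e : T → T) = id := by
      funext x
      simp
    rw [this, Measure.map_id]
  trans := by
    rintro T T' T'' ⟨e, h1, h2⟩ ⟨f, h3, h4⟩
    refine ⟨e.trans f, by simp [h1, h3], ?_⟩
    rw [← h4, ← h2, Measure.map_map f.continuous.measurable e.continuous.measurable]
    rfl

instance treeSetoid : Setoid WeightedTree := ⟨Equivalent, equivalence_equivalent⟩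

/-- The space `𝕋` of measure-preserving and root-preserving isometry classes of compact weighted
rooted real trees. -/
def TreeSpace : Type 1 := Quotient treeSetoid

/-- The isometry class of a tree. -/
def WeightedTree.toTreeSpace (T : WeightedTree) : TreeSpace := Quotient.mk treeSetoid T

/-! ### The Gromov-Hausdorff-Prokhorov topology -/

section GHP

variable {X Y : Type*}

/-- Both coordinate projections of `R ⊆ X × Y` are surjective. -/
def IsCorrespondence (R : Set (X × Y)) : Prop :=
  Prod.fst '' R = Set.univ ∧ Prod.snd '' R = Set.univ

/-- `dis(R) = sup { |d(x,y) - d'(x',y')| : (x,x'), (y,y') ∈ R }`. -/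
def distortion [MetricSpace X] [MetricSpace Y] (R : Set (X × Y)) : ℝ :=
  sSup {c | ∃ p ∈ R, ∃ q ∈ R, c = |dist p.1 q.1 - dist p.2 q.2|}

/-- Total variation distance,
`(1/2) sup { |μ(f) - ν(f)| : f measurable, |f| ≤ 1 }`, for finite measures. -/
def tvDist [MeasurableSpace X] (μ ν : Measure X) : ℝ :=
  (1 / 2) * sSup {c | ∃ f : X → ℝ, Measurable f ∧ (∀ x, |f x| ≤ 1) ∧
    c = |(∫ x, f x ∂μ) - ∫ x, f x ∂ν|}

/-- The discrepancy `D(m; μ, ν)` of a measure `m` on `X × Y`. -/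
def discrepancy [MeasurableSpace X] [MeasurableSpace Y] (m : Measure (X × Y)) (μ : Measure X)
    (ν : Measure Y) : ℝ :=
  tvDist (m.map Prod.fst) μ + tvDist (m.map Prod.snd) ν

theorem tvDist_map [MeasurableSpace X] [MeasurableSpace Y] (e : X ≃ᵐ Y) (μ ν : Measure X) :
    tvDist (μ.map e) (ν.map e) = tvDist μ ν := by
  unfold tvDist
  congr 2
  ext c
  constructor
  · rintro ⟨f, hf, hb, rfl⟩
    exact ⟨f ∘ e, hf.comp e.measurable, fun x => hb _, by
      simp [MeasureTheory.integral_map_equiv]⟩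
  · rintro ⟨f, hf, hb, rfl⟩
    exact ⟨f ∘ e.symm, hf.comp e.symm.measurable, fun x => hb _, by
      simp [MeasureTheory.integral_map_equiv]⟩

end GHP

/-- The numbers `(dis(R) / 2) ∨ D(m; μ, μ') ∨ m(Rᶜ)`, where `R` ranges over the correspondences
between `T` and `T'` that contain the pair of roots, and `m` over the finite measures on `T × T'`.
(If `R` is not measurable then `m(Rᶜ)` is the outer measure; passing to the closure of `R` changes
neither `dis(R)` nor the infimum.) -/
def ghpValues (T T' : WeightedTree) : Set ℝ :=
  {c | ∃ (R : Set (T × T')) (m : Measure (T × T')), IsFiniteMeasure m ∧ IsCorrespondence R ∧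
    (T.root, T'.root) ∈ R ∧
    c = max (max ((1 / 2) * distortion R) (discrepancy m T.μ T'.μ)) (m.real Rᶜ)}

/-- The Gromov-Hausdorff-Prokhorov distance between two trees. -/
def ghpDist (T T' : WeightedTree) : ℝ := sInf (ghpValues T T')

theorem ghpValues_subset {T₁ T₂ S₁ S₂ : WeightedTree} (h₁ : Equivalent T₁ S₁)
    (h₂ : Equivalent T₂ S₂) : ghpValues T₁ T₂ ⊆ ghpValues S₁ S₂ := by
  obtain ⟨e, he, hμ⟩ := h₁
  obtain ⟨k, hk, hν⟩ := h₂
  rintro c ⟨R, m, hm, hR, hroot, rfl⟩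
  let e' : T₁ ≃ᵐ S₁ := e.toHomeomorph.toMeasurableEquiv
  let k' : T₂ ≃ᵐ S₂ := k.toHomeomorph.toMeasurableEquiv
  let E : T₁ × T₂ ≃ᵐ S₁ × S₂ := e'.prodCongr k'
  have hE : ∀ p, E p = (e p.1, k p.2) := fun p => rfl
  have hpre : E ⁻¹' (E '' R)ᶜ = Rᶜ := by
    rw [Set.preimage_compl, Set.preimage_image_eq _ E.injective]
  refine ⟨E '' R, m.map E, inferInstance, ⟨?_, ?_⟩, ⟨_, hroot, ?_⟩, ?_⟩
  · rw [Set.eq_univ_iff_forall]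
    intro x
    have hx : e.symm x ∈ Prod.fst '' R := by rw [hR.1]; trivial
    obtain ⟨p, hp, hpx⟩ := hx
    exact ⟨E p, ⟨p, hp, rfl⟩, by rw [hE, hpx, e.apply_symm_apply]⟩
  · rw [Set.eq_univ_iff_forall]
    intro x
    have hx : k.symm x ∈ Prod.snd '' R := by rw [hR.2]; trivial
    obtain ⟨p, hp, hpx⟩ := hx
    exact ⟨E p, ⟨p, hp, rfl⟩, by rw [hE, hpx, k.apply_symm_apply]⟩
  · rw [hE, he, hk]
  · have hdis : distortion (E '' R) = distortion R := by
      unfold distortion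
      congr 1
      ext c
      constructor
      · rintro ⟨-, ⟨p, hp, rfl⟩, -, ⟨q, hq, rfl⟩, rfl⟩
        exact ⟨p, hp, q, hq, by simp only [hE, e.dist_eq, k.dist_eq]⟩
      · rintro ⟨p, hp, q, hq, rfl⟩
        exact ⟨E p, ⟨p, hp, rfl⟩, E q, ⟨q, hq, rfl⟩, by simp only [hE, e.dist_eq, k.dist_eq]⟩
    have hfst : (m.map E).map Prod.fst = (m.map Prod.fst).map e' := by
      rw [Measure.map_map measurable_fst E.measurable,
        Measure.map_map e'.measurable measurable_fst]
      rfl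
    have hsnd : (m.map E).map Prod.snd = (m.map Prod.snd).map k' := by
      rw [Measure.map_map measurable_snd E.measurable,
        Measure.map_map k'.measurable measurable_snd]
      rfl
    have hdisc : discrepancy (m.map E) S₁.μ S₂.μ = discrepancy m T₁.μ T₂.μ := by
      unfold discrepancy
      rw [hfst, hsnd, ← hμ, ← hν]
      change tvDist _ (T₁.μ.map e') + tvDist _ (T₂.μ.map k') = _
      rw [tvDist_map, tvDist_map]
    have hmass : (m.map E).real (E '' R)ᶜ = m.real Rᶜ := by
      rw [measureReal_def, E.map_apply, hpre, measureReal_def]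
    rw [hdis, hdisc, hmass]

theorem ghpDist_congr {T₁ T₂ S₁ S₂ : WeightedTree} (h₁ : Equivalent T₁ S₁)
    (h₂ : Equivalent T₂ S₂) : ghpDist T₁ T₂ = ghpDist S₁ S₂ :=
  congrArg sInf (Set.Subset.antisymm (ghpValues_subset h₁ h₂)
    (ghpValues_subset (equivalence_equivalent.symm h₁) (equivalence_equivalent.symm h₂)))

/-- The Gromov-Hausdorff-Prokhorov distance on `𝕋`. -/
def TreeSpace.ghpDist (t t' : TreeSpace) : ℝ :=
  Quotient.lift₂ RealTrees.ghpDist (fun _ _ _ _ h₁ h₂ => ghpDist_congr h₁ h₂) t t'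

/-- The Gromov-Hausdorff-Prokhorov topology on `𝕋`: a set is open when it contains a
Gromov-Hausdorff-Prokhorov ball of positive radius around each of its points. -/
instance : TopologicalSpace TreeSpace where
  IsOpen U := ∀ t ∈ U, ∃ ε > 0, ∀ t', t.ghpDist t' < ε → t' ∈ U
  isOpen_univ := fun _ _ => ⟨1, one_pos, fun _ _ => trivial⟩
  isOpen_inter := by
    rintro U V hU hV t ⟨htU, htV⟩
    obtain ⟨ε, hε, h1⟩ := hU t htU
    obtain ⟨δ, hδ, h2⟩ := hV t htV
    exact ⟨min ε δ, lt_min hε hδ, fun t' ht' =>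
      ⟨h1 t' (ht'.trans_le (min_le_left _ _)), h2 t' (ht'.trans_le (min_le_right _ _))⟩⟩
  isOpen_sUnion := by
    rintro C hC t ⟨U, hU, htU⟩
    obtain ⟨ε, hε, h1⟩ := hC U hU t htU
    exact ⟨ε, hε, fun t' ht' => ⟨U, hU, h1 t' ht'⟩⟩

/-- The Borel `σ`-field of `𝕋`. -/
instance : MeasurableSpace TreeSpace := borel TreeSpace

instance : BorelSpace TreeSpace := ⟨rfl⟩

/-! ### Subtrees -/

namespace WeightedTree

variable (T : WeightedTree)

/-- The height `H(x) = d(root, x)`. -/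
def height (x : T) : ℝ := dist T.root x

/-- The set of descendants of `y`: those `z` with `y ≼ z`, that is `y ∈ ⟦root, z⟧`. -/
def above (y : T) : Set T := {z | y ∈ seg T.root z}

theorem self_mem_above (y : T) : y ∈ T.above y :=
  T.isRealTree.mem_seg_iff.2 (by simp)

theorem isClosed_above (y : T) : IsClosed (T.above y) := by
  have : T.above y = {z | dist T.root y + dist y z = dist T.root z} := by
    ext z
    exact T.isRealTree.mem_seg_iff
  rw [this]
  exact isClosed_eq (by fun_prop) (by fun_prop)

theorem seg_subset_above (y : T) : ∀ a ∈ T.above y, ∀ b ∈ T.above y, seg a b ⊆ T.above y := by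
  intro a ha b hb z hz
  have key : ∀ c ∈ T.above y, dist y z + dist z c = dist y c → z ∈ T.above y := by
    intro c hc hzc
    have h1 := T.isRealTree.mem_seg_iff.1 hc
    have h2 := dist_triangle T.root z c
    have h3 := dist_triangle T.root y z
    exact T.isRealTree.mem_seg_iff.2 (by linarith)
  rcases T.isRealTree.seg_subset_union (y := y) hz with h | h
  · refine key a ha ?_
    have := T.isRealTree.mem_seg_iff.1 h
    rw [dist_comm y z, dist_comm z a, dist_comm y a]
    linarith
  · exact key b hb (T.isRealTree.mem_seg_iff.1 h)

/-- The subtree `T_y` above `y`, rooted at `y`, with the restrictions of the distance and of the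
measure. -/
def subtreeAbove (y : T) : WeightedTree :=
  { carrier := T.above y
    compactSpace := isCompact_iff_compactSpace.1 (T.isClosed_above y).isCompact
    isRealTree := T.isRealTree.subtype (T.seg_subset_above y)
    root := ⟨y, T.self_mem_above y⟩
    μ := T.μ.comap Subtype.val
    isFiniteMeasure := inferInstance }

/-- The ancestor `x_r` of `x` at height `r`, for `0 ≤ r ≤ H(x)`: the point at distance `r` from the
root on the geodesic from the root to `x`. (Other values of `r` are first projected to
`[0, H(x)]`; they play no role.) -/
def ancestor (r : ℝ) (x : T) : T :=
  (T.isRealTree.existsUnique_geodesic T.root x).choose (Set.projIcc 0 (dist T.root x) dist_nonneg r)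

/-- The subtree `T_{r,x}` of `T` above level `r` containing `x`. -/
def subtree (r : ℝ) (x : T) : WeightedTree := T.subtreeAbove (T.ancestor r x)

end WeightedTree

/-! ### The measure `Ψ_T` -/

/-- `Ψ` assigns to each class in `𝕋` a finite measure on `𝕋 × ℝ_+` such that, for every
representative `T` of every class and every measurable `f ≥ 0`,
`Ψ_T(f) = ∫_T μ(dx) ∫_0^{H(x)} f(T_{r,x}, r) dr`. -/
def IsPsi (Ψ : TreeSpace → FiniteMeasure (TreeSpace × ℝ≥0)) : Prop :=
  ∀ (T : WeightedTree) (f : TreeSpace × ℝ≥0 → ℝ≥0∞), Measurable f →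
    ∫⁻ p, f p ∂(Ψ T.toTreeSpace : Measure (TreeSpace × ℝ≥0)) =
      ∫⁻ x, (∫⁻ r in Set.Icc (0 : ℝ) (T.height x),
        f ((T.subtree r x).toTreeSpace, r.toNNReal) ∂volume) ∂T.μ

end

end RealTrees

/-! Trees are compared through ε-couplings (`IsCoupling`): a correspondence of distortion at most ε
and a measure carried by it, whose marginals lie below the two given measures and miss mass at most
ε. An ε-coupling bounds the GHP distance by ε, and a GHP distance less than ε yields a 7ε-coupling
(`close_of_ghpDist_lt`). Couplings compose, by gluing the measures over the middle tree
(`exists_gluing`), so the infimum of the admissible ε is a pseudometric for the GHP topology.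

The geometry enters through the Gromov product (x|z), the height at which the ancestral lines of x
and z separate: for r ≤ H(x), z lies in T_{r,x} exactly when r ≤ (x|z) (`mem_above_ancestor_iff`).
An ε-coupling changes these products by at most 2ε. Hence, for corresponding x and x', the subtrees
T_{r,x} and T'_{r,x'} match except for points z with (x|z) within 2ε of r. If those points have
small mass and stay close to x_r, the subtrees are close (`IsCoupling.close_subtree`).

For fixed x, the levels r that stay bad at every scale are countable: the height H(x), the atoms of
the image of μ under (x|·), and the levels where a branch reaching distance at least h leaves the
ancestral line; in a compact tree the latter are countable because their tips are separated. By
Fubini the bad pairs (x, r) have small measure at small scales (`exists_badSet_le`). Integrating a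
bounded Lipschitz f against a coupling then shows that Ψ_T(f) is continuous in T, and such f
determine weak convergence.

For measurability, T_y is the limit of the subtrees above ancestors of y approaching y from below
(`tendsto_subtree`), and ancestors taken at suitable grid levels form a countable set. -/

namespace RealTrees

/-! ### Medians and the four-point inequality. -/

namespace IsRealTree

variable {X : Type*} [MetricSpace X]

/-- Any three points of a real tree have a median. -/
theorem exists_median (h : IsRealTree X) (a b c : X) : ∃ p : X,
    dist a p + dist p b = dist a b ∧ dist a p + dist p c = dist a c ∧
      dist b p + dist p c = dist b c := by
  obtain ⟨g, -, g0, g1, gd, gr⟩ := h.exists_path a b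
  have t1 := dist_triangle a b c
  have t2 := dist_triangle b a c
  have t3 := dist_triangle a c b
  rw [dist_comm b a] at t2
  rw [dist_comm c b] at t3
  -- The three required equations force this value for the distance from `a` to the median.
  have hs : (dist a b + dist a c - dist b c) / 2 ∈ Set.Icc 0 (dist a b) :=
    ⟨by linarith, by linarith⟩
  have e1 := gd 0 ⟨le_rfl, dist_nonneg⟩ _ hs
  have e2 := gd _ hs _ ⟨dist_nonneg, le_rfl⟩
  rw [g0, abs_sub_comm, sub_zero, abs_of_nonneg hs.1] at e1
  rw [g1, abs_sub_comm, abs_of_nonneg (sub_nonneg.2 hs.2)] at e2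
  refine ⟨g ((dist a b + dist a c - dist b c) / 2), by linarith, ?_⟩
  set p := g ((dist a b + dist a c - dist b c) / 2)
  have hp : p ∈ seg a b := (gr _).2 ⟨_, hs, rfl⟩
  rw [dist_comm b p]
  -- Either alternative is one of the two missing equations; the choice of the distance from `a`
  -- makes them equivalent.
  rcases h.seg_subset_union (y := c) hp with hq | hq
  · have := h.mem_seg_iff.1 hq
    constructor <;> linarith
  · have := h.mem_seg_iff.1 hq
    rw [dist_comm c p, dist_comm c b] at this
    constructor <;> linarith

/-- The four-point inequality. -/
theorem four_point (h : IsRealTree X) (a b c e : X) :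
    dist a b + dist c e ≤ max (dist a c + dist b e) (dist a e + dist b c) := by
  obtain ⟨p, h1, h2, h3⟩ := h.exists_median a b c
  have t1 := dist_triangle c p e
  rw [dist_comm c p] at t1
  rw [dist_comm b p] at h3
  -- The median `p` lies on the segment from `e` to `a` or to `b`; going from `c` to `e` through `p`
  -- then bounds the left side by the corresponding sum.
  rcases h.seg_subset_union (y := e) (h.mem_seg_iff.2 h1) with hq | hq
  · have := h.mem_seg_iff.1 hq
    exact le_max_of_le_right (by linarith)
  · have := h.mem_seg_iff.1 hq
    rw [dist_comm e p, dist_comm e b] at this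
    exact le_max_of_le_left (by linarith)

end IsRealTree

/-! ### Heights, Gromov products, ancestors and branching levels. -/

namespace WeightedTree

variable (T : WeightedTree)

/-- The Gromov product of `x` and `z` based at the root: the height of their branch point. -/
noncomputable def gromovProd (x z : T) : ℝ := (T.height x + T.height z - dist x z) / 2

theorem height_nonneg (x : T) : 0 ≤ T.height x := dist_nonneg

@[fun_prop]
theorem continuous_height : Continuous T.height := by
  unfold height
  fun_prop

theorem abs_height_sub_le (x z : T) : |T.height x - T.height z| ≤ dist x z := by
  unfold height
  rw [dist_comm T.root x, dist_comm T.root z]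
  exact abs_dist_sub_le x z T.root

theorem exists_height_le : ∃ K : ℝ, 0 ≤ K ∧ ∀ x : T, T.height x ≤ K := by
  obtain ⟨K, hK⟩ := (isCompact_univ (X := T)).bddAbove_image T.continuous_height.continuousOn
  exact ⟨K, (T.height_nonneg T.root).trans (hK ⟨_, trivial, rfl⟩), fun x => hK ⟨x, trivial, rfl⟩⟩

@[fun_prop]
theorem continuous_gromovProd : Continuous fun p : T × T => T.gromovProd p.1 p.2 := by
  unfold gromovProd
  fun_prop

theorem continuous_gromovProd_right (x : T) : Continuous (T.gromovProd x) :=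
  T.continuous_gromovProd.comp (Continuous.prodMk_right x)

theorem gromovProd_le_left (x z : T) : T.gromovProd x z ≤ T.height x := by
  have := (abs_le.1 (T.abs_height_sub_le x z)).1
  unfold gromovProd
  linarith

theorem gromovProd_le_right (x z : T) : T.gromovProd x z ≤ T.height z := by
  have := (abs_le.1 (T.abs_height_sub_le x z)).2
  unfold gromovProd
  linarith

theorem gromovProd_nonneg (x z : T) : 0 ≤ T.gromovProd x z := by
  have := dist_triangle_left x z T.root
  unfold gromovProd height
  linarith

theorem gromovProd_comm (x z : T) : T.gromovProd x z = T.gromovProd z x := by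
  unfold gromovProd
  rw [dist_comm x z]
  ring

/-- The ultrametric inequality for the Gromov product. -/
theorem min_gromovProd_le (x y z : T) :
    min (T.gromovProd x y) (T.gromovProd y z) ≤ T.gromovProd x z := by
  have := T.isRealTree.four_point x z T.root y
  unfold gromovProd height
  rw [dist_comm x T.root, dist_comm z T.root, dist_comm z y] at this
  rcases le_max_iff.1 this with h | h
  · exact min_le_of_right_le (by linarith)
  · exact min_le_of_left_le (by linarith)

theorem ancestor_spec (r : ℝ) (x : T) :
    dist T.root (T.ancestor r x) = max 0 (min (T.height x) r) ∧
      dist (T.ancestor r x) x = T.height x - max 0 (min (T.height x) r) := by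
  have hf := (T.isRealTree.existsUnique_geodesic T.root x).choose_spec.1
  set f := (T.isRealTree.existsUnique_geodesic T.root x).choose with hfd
  have ha : T.ancestor r x = f (Set.projIcc 0 (dist T.root x) dist_nonneg r) := rfl
  have hp := (Set.projIcc 0 (dist T.root x) dist_nonneg r).2
  have hc : ((Set.projIcc 0 (dist T.root x) dist_nonneg r : Set.Icc (0 : ℝ) (dist T.root x)) : ℝ)
      = max 0 (min (T.height x) r) := rfl
  constructor
  · have h1 := hf.isometry.dist_eq ⟨0, le_rfl, dist_nonneg⟩
      (Set.projIcc 0 (dist T.root x) dist_nonneg r)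
    rw [hf.left, ← ha, Subtype.dist_eq, Real.dist_eq, hc, zero_sub, abs_neg,
      abs_of_nonneg (le_max_left _ _)] at h1
    exact h1
  · have h1 := hf.isometry.dist_eq (Set.projIcc 0 (dist T.root x) dist_nonneg r)
      ⟨dist T.root x, dist_nonneg, le_rfl⟩
    rw [hf.right, ← ha, Subtype.dist_eq, Real.dist_eq, hc, abs_sub_comm, abs_of_nonneg] at h1
    · exact h1
    · rw [← hc]
      exact sub_nonneg.2 hp.2

theorem height_ancestor {r : ℝ} {x : T} (h0 : 0 ≤ r) (h1 : r ≤ T.height x) :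
    T.height (T.ancestor r x) = r := by
  have := (T.ancestor_spec r x).1
  rwa [min_eq_right h1, max_eq_right h0] at this

theorem dist_ancestor {r : ℝ} {x : T} (h0 : 0 ≤ r) (h1 : r ≤ T.height x) :
    dist (T.ancestor r x) x = T.height x - r := by
  have := (T.ancestor_spec r x).2
  rwa [min_eq_right h1, max_eq_right h0] at this

/-- A point whose distances to the root and to `x` are close to those of the ancestor of `x` at
height `r` is close to that ancestor. -/
theorem dist_ancestor_le {r α : ℝ} {x w : T} (h0 : 0 ≤ r) (h1 : r ≤ T.height x)
    (hw : T.height w ≤ r + α) (hx : dist w x ≤ T.height x - r + α) :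
    dist w (T.ancestor r x) ≤ α := by
  have h2 := T.height_ancestor h0 h1
  have h3 := T.dist_ancestor h0 h1
  -- Here d(w, x_r) + H(x) is at most the larger of H(w) + d(x_r, x) and d(w, x) + r, and both are
  -- at most H(x) + α.
  have := T.isRealTree.four_point w (T.ancestor r x) T.root x
  unfold height at *
  rw [dist_comm w T.root, dist_comm _ T.root, h2, h3] at this
  rcases le_max_iff.1 this with h | h <;> linarith

theorem ancestor_height (y : T) : T.ancestor (T.height y) y = y := by
  have := T.dist_ancestor (T.height_nonneg y) le_rfl
  exact dist_eq_zero.1 (by linarith)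

/-- Reduces statements about arbitrary `r` to the range 0 ≤ r ≤ H(x). -/
theorem ancestor_clamp (r : ℝ) (x : T) :
    T.ancestor (max 0 (min (T.height x) r)) x = T.ancestor r x := by
  refine congrArg (T.isRealTree.existsUnique_geodesic T.root x).choose (Subtype.ext ?_)
  have h := T.height_nonneg x
  change max 0 (min (T.height x) (max 0 (min (T.height x) r))) = max 0 (min (T.height x) r)
  rw [min_eq_right (max_le h (min_le_left _ _)), max_eq_right (le_max_left _ _)]

/-- `dist_ancestor_le` is applied to the ancestor of `w`. The distance d(x, w) is paid three times:
in the clamped levels, in the heights, and in passing from `w` to `x`. -/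
theorem dist_ancestor_ancestor_le (r s : ℝ) (x w : T) :
    dist (T.ancestor r x) (T.ancestor s w) ≤ |r - s| + 3 * dist x w := by
  rw [← T.ancestor_clamp r x, ← T.ancestor_clamp s w]
  have hx := T.height_nonneg x
  have hw := T.height_nonneg w
  have hxw := abs_le.1 (T.abs_height_sub_le x w)
  have hr0 : 0 ≤ max 0 (min (T.height x) r) := le_max_left _ _
  have hs0 : 0 ≤ max 0 (min (T.height w) s) := le_max_left _ _
  have hr1 : max 0 (min (T.height x) r) ≤ T.height x := max_le hx (min_le_left _ _)
  have hs1 : max 0 (min (T.height w) s) ≤ T.height w := max_le hw (min_le_left _ _)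
  have hrs : |max 0 (min (T.height x) r) - max 0 (min (T.height w) s)| ≤ |r - s| + dist x w := by
    have h1 := abs_max_sub_max_le_max 0 (min (T.height x) r) 0 (min (T.height w) s)
    have h2 := abs_min_sub_min_le_max (T.height x) r (T.height w) s
    have h3 := T.abs_height_sub_le x w
    rw [sub_zero, abs_zero] at h1
    refine h1.trans (max_le (by positivity) (h2.trans (max_le ?_ ?_)))
    · linarith [abs_nonneg (r - s)]
    · linarith [dist_nonneg (x := x) (y := w)]
  generalize max 0 (min (T.height x) r) = r' at *
  generalize max 0 (min (T.height w) s) = s' at *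
  have hrs' := abs_le.1 hrs
  rw [dist_comm]
  refine (T.dist_ancestor_le hr0 hr1 (α := |r - s| + 3 * dist x w) ?_ ?_)
  · rw [T.height_ancestor hs0 hs1]
    linarith [dist_nonneg (x := x) (y := w)]
  · have h1 := T.dist_ancestor hs0 hs1
    have h2 := dist_triangle (T.ancestor s' w) w x
    rw [dist_comm w x] at h2
    linarith

theorem continuous_ancestor : Continuous fun p : ℝ × T => T.ancestor p.1 p.2 := by
  refine continuous_iff_continuousAt.2 fun p => ?_
  refine tendsto_iff_dist_tendsto_zero.2 ?_
  have h : Continuous fun q : ℝ × T => |q.1 - p.1| + 3 * dist q.2 p.2 := by fun_prop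
  have h0 := h.tendsto p
  simp only [sub_self, abs_zero, dist_self, mul_zero, add_zero] at h0
  exact squeeze_zero (fun _ => dist_nonneg)
    (fun q => T.dist_ancestor_ancestor_le q.1 p.1 q.2 p.2) h0

theorem mem_above_iff {y z : T} : z ∈ T.above y ↔ T.height y + dist y z = T.height z :=
  T.isRealTree.mem_seg_iff

/-- Membership in a subtree becomes an inequality between distances, which is stable under
couplings. The converse direction is the four-point inequality for x_r, z, the root and x. -/
theorem mem_above_ancestor_iff {r : ℝ} {x z : T} (h0 : 0 ≤ r) (h1 : r ≤ T.height x) :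
    z ∈ T.above (T.ancestor r x) ↔ r ≤ T.gromovProd x z := by
  have h2 := T.height_ancestor h0 h1
  have h3 := T.dist_ancestor h0 h1
  rw [mem_above_iff, h2]
  constructor
  · intro h
    have := dist_triangle x (T.ancestor r x) z
    rw [dist_comm x (T.ancestor r x)] at this
    unfold gromovProd
    linarith
  · intro h
    have h4 := T.isRealTree.four_point (T.ancestor r x) z T.root x
    have h5 := dist_triangle T.root (T.ancestor r x) z
    unfold gromovProd height at *
    rw [dist_comm _ T.root, h2, h3, dist_comm z x, dist_comm z T.root] at h4
    rw [h2] at h5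
    refine le_antisymm ?_ h5
    rcases le_max_iff.1 h4 with h | h <;> linarith

theorem mem_above_iff_gromovProd {y z : T} : z ∈ T.above y ↔ T.height y ≤ T.gromovProd y z := by
  have := T.mem_above_ancestor_iff (z := z) (T.height_nonneg y) le_rfl
  rwa [T.ancestor_height] at this

/-- Branches that leave the ancestral line of `x` at two distinct heights are far apart. -/
theorem dist_le_of_gromovProd_lt {x z w : T} (h : T.gromovProd x z < T.gromovProd x w) :
    dist z (T.ancestor (T.gromovProd x z) x) ≤ dist z w := by
  have h0 := T.gromovProd_nonneg x z
  have h1 := T.gromovProd_le_left x z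
  have h2 := T.gromovProd_le_right x w
  have h3 := T.mem_above_iff.1 ((T.mem_above_ancestor_iff h0 h1).2 le_rfl)
  rw [T.height_ancestor h0 h1] at h3
  -- Since (x|w) exceeds (x|z), the ultrametric inequality leaves only (w|z) ≤ (x|z): the path from
  -- `z` to `w` descends at least to the level where `z` leaves the line of `x`.
  have h4 := T.min_gromovProd_le x w z
  have h5 : T.gromovProd w z ≤ T.gromovProd x z := by
    rcases min_le_iff.1 h4 with h' | h'
    · linarith
    · exact h'
  have h6 : dist z w = T.height z + T.height w - 2 * T.gromovProd w z := by
    unfold gromovProd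
    rw [dist_comm w z]
    ring
  rw [dist_comm z (T.ancestor _ _), h6]
  linarith

/-- A family of points at pairwise distances at least `h > 0` is countable. -/
theorem countable_of_separated {ι : Type*} {s : Set ι} {h : ℝ} (hh : 0 < h) (g : ι → T)
    (hg : ∀ i ∈ s, ∀ j ∈ s, i ≠ j → h ≤ dist (g i) (g j)) : s.Countable := by
  -- Disjoint nonempty open balls in a separable space are countable in number.
  refine Set.PairwiseDisjoint.countable_of_isOpen (s := fun i => Metric.ball (g i) (h / 2))
    ?_ (fun _ _ => Metric.isOpen_ball) (fun i _ => ⟨g i, Metric.mem_ball_self (by linarith)⟩)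
  intro i hi j hj hij
  exact Metric.ball_disjoint_ball (by linarith [hg i hi j hj hij])

/-- Witnesses for two distinct levels are at distance at least `h` by `dist_le_of_gromovProd_lt`, so
one witness per level gives a separated family. -/
theorem countable_branching (x : T) {h : ℝ} (hh : 0 < h) :
    {r : ℝ | ∃ z, T.gromovProd x z = r ∧ h ≤ dist z (T.ancestor r x)}.Countable := by
  have hc : ∀ r : ℝ, ∃ z : T, r ∈ {r : ℝ | ∃ z, T.gromovProd x z = r ∧
      h ≤ dist z (T.ancestor r x)} → T.gromovProd x z = r ∧ h ≤ dist z (T.ancestor r x) := by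
    intro r
    by_cases hr : r ∈ {r : ℝ | ∃ z, T.gromovProd x z = r ∧ h ≤ dist z (T.ancestor r x)}
    · obtain ⟨z, hz⟩ := hr
      exact ⟨z, fun _ => hz⟩
    · exact ⟨x, fun hr' => absurd hr' hr⟩
  choose g hg using hc
  refine T.countable_of_separated hh g ?_
  have key : ∀ r s, T.gromovProd x (g r) = r ∧ h ≤ dist (g r) (T.ancestor r x) →
      T.gromovProd x (g s) = s → r < s → h ≤ dist (g r) (g s) := by
    intro r s hr hs hrs
    have := T.dist_le_of_gromovProd_lt (x := x) (z := g r) (w := g s) (by rw [hr.1, hs]; exact hrs)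
    rw [hr.1] at this
    exact hr.2.trans this
  intro r hr s hs hrs
  rcases lt_or_gt_of_ne hrs with hlt | hlt
  · exact key r s (hg r hr) (hg s hs).1 hlt
  · rw [dist_comm]
    exact key s r (hg s hs) (hg r hr).1 hlt

end WeightedTree

end RealTrees

/-! ### Gluing of measures and total variation estimates. -/

namespace RealTrees

/-- Two measures on `X × Y` and `Y × Z` whose marginals on `Y` are dominated by a common finite
measure can be glued along `Y`. -/
theorem exists_gluing {X Y Z : Type*} [MeasurableSpace X] [StandardBorelSpace X] [Nonempty X]
    [MeasurableSpace Y] [MeasurableSpace Z] [StandardBorelSpace Z] [Nonempty Z]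
    (m : Measure (X × Y)) (m' : Measure (Y × Z)) (μ : Measure Y) [IsFiniteMeasure m]
    [IsFiniteMeasure m'] [IsFiniteMeasure μ] (h : m.map Prod.snd ≤ μ) (h' : m'.map Prod.fst ≤ μ) :
    ∃ M : Measure (X × Z), M.map Prod.fst ≤ m.map Prod.fst ∧ M.map Prod.snd ≤ m'.map Prod.snd ∧
      m Set.univ + m' Set.univ ≤ M Set.univ + μ Set.univ ∧
      ∀ (S : Set (X × Y)) (S' : Set (Y × Z)) (W : Set (X × Z)), MeasurableSet S →
        MeasurableSet S' → MeasurableSet W → m S = 0 → m' S' = 0 →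
        (∀ x y z, (x, z) ∈ W → (x, y) ∈ S ∨ (y, z) ∈ S') → M W = 0 := by
  have hν : (m.map Prod.swap).fst = m.map Prod.snd := by
    rw [Measure.fst, Measure.map_map measurable_fst measurable_swap]
    rfl
  have hm : (m.map Prod.snd).compProd (m.map Prod.swap).condKernel = m.map Prod.swap := by
    rw [← hν]
    exact Measure.disintegrate _ _
  have hm' : (m'.map Prod.fst).compProd m'.condKernel = m' := Measure.disintegrate _ _
  set K := (m.map Prod.swap).condKernel
  set K' := m'.condKernel
  set ν := m.map Prod.snd
  set ν' := m'.map Prod.fst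
  have : IsFiniteMeasure ν := isFiniteMeasure_of_le μ h
  have : IsFiniteMeasure ν' := isFiniteMeasure_of_le μ h'
  set a := ν.rnDeriv μ
  set b := ν'.rnDeriv μ
  have ha : Measurable a := Measure.measurable_rnDeriv _ _
  have hb : Measurable b := Measure.measurable_rnDeriv _ _
  have ha1 : ∀ᵐ y ∂μ, a y ≤ 1 := Measure.rnDeriv_le_one_of_le h
  have hb1 : ∀ᵐ y ∂μ, b y ≤ 1 := Measure.rnDeriv_le_one_of_le h'
  have hνa : μ.withDensity a = ν :=
    Measure.withDensity_rnDeriv_eq _ _ (Measure.absolutelyContinuous_of_le h)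
  have hνb : μ.withDensity b = ν' :=
    Measure.withDensity_rnDeriv_eq _ _ (Measure.absolutelyContinuous_of_le h')
  -- Densities at most 1 satisfy ab ≤ min(a, b), which dominates both marginals, and a + b ≤ 1 + ab,
  -- which gives the mass bound.
  set ρ := μ.withDensity (a * b)
  have hρ : ρ ≤ ν := by
    rw [← hνa]
    refine withDensity_mono ?_
    filter_upwards [hb1] with y hy
    exact mul_le_of_le_one_right' hy
  have hρ' : ρ ≤ ν' := by
    rw [← hνb]
    refine withDensity_mono ?_
    filter_upwards [ha1] with y hy
    exact mul_le_of_le_one_left' hy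
  have happ : ∀ S, MeasurableSet S → ρ.bind (K.prod K') S = ∫⁻ y, ((K y).prod (K' y)) S ∂ρ := by
    intro S hS
    rw [Measure.bind_apply hS (ProbabilityTheory.Kernel.aemeasurable _)]
    simp_rw [ProbabilityTheory.Kernel.prod_apply]
  -- Given `y`, the two outer coordinates are drawn independently from the conditional laws.
  refine ⟨ρ.bind (K.prod K'), ?_, ?_, ?_, ?_⟩
  · refine Measure.le_iff.2 fun A hA => ?_
    rw [Measure.map_apply measurable_fst hA, Measure.map_apply measurable_fst hA,
      happ _ (measurable_fst hA)]
    have e1 : m (Prod.fst ⁻¹' A) = ∫⁻ y, K y A ∂ν := by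
      have : m (Prod.fst ⁻¹' A) = (m.map Prod.swap) (Prod.snd ⁻¹' A) := by
        rw [Measure.map_apply measurable_swap (measurable_snd hA)]
        rfl
      rw [this, ← hm, Measure.compProd_apply (measurable_snd hA)]
      rfl
    rw [e1]
    refine (lintegral_mono fun y => ?_).trans (lintegral_mono' hρ le_rfl)
    rw [← Set.prod_univ, Measure.prod_prod]
    simp
  · refine Measure.le_iff.2 fun A hA => ?_
    rw [Measure.map_apply measurable_snd hA, Measure.map_apply measurable_snd hA,
      happ _ (measurable_snd hA)]
    have e1 : m' (Prod.snd ⁻¹' A) = ∫⁻ y, K' y A ∂ν' := by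
      conv_lhs => rw [← hm']
      rw [Measure.compProd_apply (measurable_snd hA)]
      rfl
    rw [e1]
    refine (lintegral_mono fun y => ?_).trans (lintegral_mono' hρ' le_rfl)
    rw [← Set.univ_prod, Measure.prod_prod]
    simp
  · rw [happ _ MeasurableSet.univ]
    have e1 : m Set.univ = ∫⁻ y, a y ∂μ := by
      rw [← setLIntegral_univ, ← withDensity_apply _ MeasurableSet.univ, hνa,
        Measure.map_apply measurable_snd MeasurableSet.univ, Set.preimage_univ]
    have e2 : m' Set.univ = ∫⁻ y, b y ∂μ := by
      rw [← setLIntegral_univ, ← withDensity_apply _ MeasurableSet.univ, hνb,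
        Measure.map_apply measurable_fst MeasurableSet.univ, Set.preimage_univ]
    have e3 : ∫⁻ y, ((K y).prod (K' y)) Set.univ ∂ρ = ∫⁻ y, (a * b) y ∂μ := by
      simp only [measure_univ, lintegral_one]
      rw [withDensity_apply _ MeasurableSet.univ, setLIntegral_univ]
    have e4 : μ Set.univ = ∫⁻ _, 1 ∂μ := by simp
    rw [e1, e2, e3, e4, ← lintegral_add_left ha, ← lintegral_add_left (ha.mul hb)]
    refine lintegral_mono_ae ?_
    filter_upwards [ha1, hb1] with y h1 h2
    rw [Pi.mul_apply]
    lift a y to ℝ≥0 using ne_top_of_le_ne_top ENNReal.one_ne_top h1 with s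
    lift b y to ℝ≥0 using ne_top_of_le_ne_top ENNReal.one_ne_top h2 with t
    norm_cast at h1 h2 ⊢
    rw [← NNReal.coe_le_coe] at h1 h2 ⊢
    push_cast at *
    nlinarith
  -- For almost every `y`, `W` is covered by two cylinders over the null sections of `S` and `S'`.
  -- In the application the three sets are complements of two closed correspondences and of their
  -- composition.
  · intro S S' W hS hS' hW hmS hmS' hSW
    rw [happ _ hW]
    have k1 : ∀ᵐ y ∂ρ, K y ((fun x => (x, y)) ⁻¹' S) = 0 := by
      refine ae_mono hρ ?_
      have : (ν.compProd K) (Prod.swap ⁻¹' S) = 0 := by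
        rw [hm, Measure.map_apply measurable_swap (measurable_swap hS), ← Set.preimage_comp]
        simpa using hmS
      rw [Measure.compProd_apply (measurable_swap hS), lintegral_eq_zero_iff
        (ProbabilityTheory.Kernel.measurable_kernel_prodMk_left (measurable_swap hS))] at this
      exact this
    have k2 : ∀ᵐ y ∂ρ, K' y (Prod.mk y ⁻¹' S') = 0 := by
      refine ae_mono hρ' ?_
      have : (ν'.compProd K') S' = 0 := by rw [hm', hmS']
      rw [Measure.compProd_apply hS', lintegral_eq_zero_iff
        (ProbabilityTheory.Kernel.measurable_kernel_prodMk_left hS')] at this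
      exact this
    rw [lintegral_eq_zero_iff' ?_]
    · filter_upwards [k1, k2] with y h1 h2
      refine measure_mono_null (t := ((fun x => (x, y)) ⁻¹' S) ×ˢ Set.univ ∪
        Set.univ ×ˢ (Prod.mk y ⁻¹' S')) ?_ ?_
      · rintro ⟨x, z⟩ hxz
        rcases hSW x y z hxz with h3 | h3
        · exact Or.inl ⟨h3, trivial⟩
        · exact Or.inr ⟨trivial, h3⟩
      · refine measure_union_null ?_ ?_ <;> rw [Measure.prod_prod]
        · rw [h1, zero_mul]
        · rw [h2, mul_zero]
    · have := ProbabilityTheory.Kernel.measurable_coe (K.prod K') hW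
      simp_rw [ProbabilityTheory.Kernel.prod_apply] at this
      exact this.aemeasurable

theorem abs_integral_le_of_abs_le_one {X : Type*} [MeasurableSpace X] (μ : Measure X)
    [IsFiniteMeasure μ] {f : X → ℝ} (hf : ∀ x, |f x| ≤ 1) : |∫ x, f x ∂μ| ≤ μ.real Set.univ := by
  have := norm_integral_le_of_norm_le_const (μ := μ) (f := f)
    (Filter.Eventually.of_forall fun x => hf x)
  simpa using this

theorem integrable_of_abs_le {X : Type*} [MeasurableSpace X] (μ : Measure X)
    [IsFiniteMeasure μ] {f : X → ℝ} (hm : Measurable f) {M : ℝ} (hf : ∀ x, |f x| ≤ M) :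
    Integrable f μ :=
  Integrable.of_bound hm.aestronglyMeasurable M (Filter.Eventually.of_forall fun x => hf x)

/-- Integrals of bounded functions against nested finite measures. -/
theorem abs_integral_sub_le_of_le {X : Type*} [MeasurableSpace X] {μ ν : Measure X}
    [IsFiniteMeasure μ] (h : ν ≤ μ) {f : X → ℝ} (hm : Measurable f) {M : ℝ}
    (hf : ∀ x, |f x| ≤ M) :
    |(∫ x, f x ∂μ) - ∫ x, f x ∂ν| ≤ M * (μ.real Set.univ - ν.real Set.univ) := by
  have : IsFiniteMeasure ν := isFiniteMeasure_of_le μ h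
  have e := Measure.sub_add_cancel_of_le h
  have h1 : ∫ x, f x ∂μ = (∫ x, f x ∂(μ - ν)) + ∫ x, f x ∂ν := by
    conv_lhs => rw [← e]
    exact integral_add_measure (integrable_of_abs_le _ hm hf) (integrable_of_abs_le _ hm hf)
  have h2 : μ.real Set.univ = (μ - ν).real Set.univ + ν.real Set.univ := by
    conv_lhs => rw [← e]
    exact measureReal_add_apply
  rw [h1, h2, add_sub_cancel_right, add_sub_cancel_right]
  exact norm_integral_le_of_norm_le_const (μ := μ - ν) (f := f)
    (Filter.Eventually.of_forall fun x => hf x)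

/-- Boundedness is what makes the real supremum in `tvDist` an upper bound for its set. -/
theorem bddAbove_tvDist {X : Type*} [MeasurableSpace X] (μ ν : Measure X) [IsFiniteMeasure μ]
    [IsFiniteMeasure ν] : BddAbove {c | ∃ f : X → ℝ, Measurable f ∧ (∀ x, |f x| ≤ 1) ∧
      c = |(∫ x, f x ∂μ) - ∫ x, f x ∂ν|} := by
  refine ⟨μ.real Set.univ + ν.real Set.univ, ?_⟩
  rintro c ⟨f, -, hf, rfl⟩
  exact (abs_sub _ _).trans (add_le_add (abs_integral_le_of_abs_le_one μ hf)
    (abs_integral_le_of_abs_le_one ν hf))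

theorem tvDist_nonneg {X : Type*} [MeasurableSpace X] (μ ν : Measure X) : 0 ≤ tvDist μ ν := by
  refine mul_nonneg (by norm_num) (Real.sSup_nonneg ?_)
  rintro c ⟨f, -, -, rfl⟩
  exact abs_nonneg _

/-- The indicator of `A` is an admissible test function. Since the total masses may differ, the
factor 2 is sharp: take ν = 0 and `A` the whole space. -/
theorem abs_measureReal_sub_le_tvDist {X : Type*} [MeasurableSpace X] (μ ν : Measure X)
    [IsFiniteMeasure μ] [IsFiniteMeasure ν] {A : Set X} (hA : MeasurableSet A) :
    |μ.real A - ν.real A| ≤ 2 * tvDist μ ν := by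
  unfold tvDist
  rw [← mul_assoc, mul_one_div_cancel two_ne_zero, one_mul]
  refine le_csSup (bddAbove_tvDist μ ν) ⟨A.indicator 1, measurable_one.indicator hA, ?_, ?_⟩
  · intro x
    by_cases hx : x ∈ A <;> simp [hx]
  · rw [integral_indicator_one hA, integral_indicator_one hA]

theorem tvDist_le_of_le {X : Type*} [MeasurableSpace X] {μ ν : Measure X} [IsFiniteMeasure μ]
    (h : ν ≤ μ) {ε : ℝ} (hε : μ.real Set.univ ≤ ν.real Set.univ + ε) : tvDist ν μ ≤ ε / 2 := by
  have : sSup {c | ∃ f : X → ℝ, Measurable f ∧ (∀ x, |f x| ≤ 1) ∧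
      c = |(∫ x, f x ∂ν) - ∫ x, f x ∂μ|} ≤ ε := by
    refine csSup_le ⟨_, 0, measurable_zero, by simp, rfl⟩ ?_
    rintro c ⟨f, hm, hf, rfl⟩
    have := abs_integral_sub_le_of_le h hm hf
    rw [abs_sub_comm]
    linarith
  unfold tvDist
  linarith

/-- A finite measure can be cut down by a density `≤ 1` so as to be dominated by `μ`, at a cost
controlled by the total variation distance. -/
theorem exists_density_le {X : Type*} [MeasurableSpace X] (ν μ : Measure X) [IsFiniteMeasure μ]
    [IsFiniteMeasure ν] : ∃ g : X → ℝ≥0∞, Measurable g ∧ (∀ x, g x ≤ 1) ∧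
      ν.withDensity g ≤ μ ∧ ∫⁻ x, (1 - g x) ∂ν ≤ ENNReal.ofReal (2 * tvDist ν μ) := by
  set D := μ.rnDeriv ν
  have hD : Measurable D := Measure.measurable_rnDeriv _ _
  refine ⟨fun x => min 1 (D x), measurable_const.min hD, fun x => min_le_left _ _, ?_, ?_⟩
  · refine (withDensity_mono (Filter.Eventually.of_forall fun x => min_le_right _ _)).trans
      (Measure.withDensity_rnDeriv_le μ ν)
  -- `N` carries ν and is null for the singular part of μ. The loss 1 - g lives on the part `A` of
  -- `N` where the density is below 1, and its integral there is ν(A) - μ(A).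
  · obtain ⟨N, hN, hs, hνN⟩ := Measure.mutuallySingular_singularPart μ ν
    set A := {x | D x < 1} ∩ N
    have hA : MeasurableSet A := (measurableSet_lt hD measurable_const).inter hN
    have hμA : μ A = ∫⁻ x in A, D x ∂ν := by
      conv_lhs => rw [Measure.haveLebesgueDecomposition_add μ ν]
      rw [Measure.add_apply, measure_mono_null Set.inter_subset_right hs, zero_add,
        withDensity_apply _ hA]
    have h1 : ∫⁻ x, (1 - min 1 (D x)) ∂ν ≤ ∫⁻ x in A, (1 - D x) ∂ν := by
      rw [← lintegral_indicator hA]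
      refine lintegral_mono_ae ?_
      have : ∀ᵐ x ∂ν, x ∈ N := by
        rw [ae_iff]
        exact hνN
      filter_upwards [this] with x hx
      by_cases hx1 : D x < 1
      · rw [Set.indicator_of_mem (show x ∈ A from ⟨hx1, hx⟩), min_eq_right hx1.le]
      · rw [min_eq_left (not_lt.1 hx1), tsub_self]
        exact zero_le
    have hfin : ∫⁻ x in A, D x ∂ν ≠ ∞ := by
      rw [← hμA]
      exact measure_ne_top _ _
    have h2 : ∫⁻ x in A, (1 - D x) ∂ν = ν A - μ A := by
      rw [lintegral_sub hD hfin, setLIntegral_one, hμA]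
      refine (ae_restrict_iff' hA).2 (Filter.Eventually.of_forall fun x hx => hx.1.le)
    refine h1.trans ?_
    rw [h2, ← ENNReal.ofReal_toReal (measure_ne_top ν A), ← ENNReal.ofReal_toReal
      (measure_ne_top μ A), ← ENNReal.ofReal_sub _ ENNReal.toReal_nonneg]
    exact ENNReal.ofReal_le_ofReal ((le_abs_self _).trans (abs_measureReal_sub_le_tvDist ν μ hA))

end RealTrees

/-! ### Couplings of trees and their relation to the GHP distance. -/

namespace RealTrees

/-- An `ε`-coupling of two trees: a correspondence with distortion at most `ε` that contains the
pair of roots, and a measure carried by it with marginals dominated by the measures of the trees,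
up to a mass `ε`. -/
structure IsCoupling {T T' : WeightedTree} (R : Set (T × T')) (m : Measure (T × T')) (ε : ℝ) :
    Prop where
  root_mem : (T.root, T'.root) ∈ R
  exists_right : ∀ x, ∃ x', (x, x') ∈ R
  exists_left : ∀ x', ∃ x, (x, x') ∈ R
  abs_sub_le : ∀ p ∈ R, ∀ q ∈ R, |dist p.1 q.1 - dist p.2 q.2| ≤ ε
  null : m Rᶜ = 0
  map_fst_le : m.map Prod.fst ≤ T.μ
  map_snd_le : m.map Prod.snd ≤ T'.μ
  mass_left : T.μ.real Set.univ ≤ m.real Set.univ + ε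
  mass_right : T'.μ.real Set.univ ≤ m.real Set.univ + ε

/-- Existence of an `ε`-coupling. -/
def Close (ε : ℝ) (T T' : WeightedTree) : Prop :=
  ∃ (R : Set (T × T')) (m : Measure (T × T')), IsCoupling R m ε

theorem measureReal_map_univ {X Y : Type*} [MeasurableSpace X] [MeasurableSpace Y] (m : Measure X)
    {f : X → Y} (hf : Measurable f) : (m.map f).real Set.univ = m.real Set.univ := by
  rw [map_measureReal_apply hf MeasurableSet.univ, Set.preimage_univ]

theorem abs_dist_sub_le_of_mem_closure {X Y : Type*} [MetricSpace X] [MetricSpace Y]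
    {R : Set (X × Y)} {ε : ℝ} (h : ∀ p ∈ R, ∀ q ∈ R, |dist p.1 q.1 - dist p.2 q.2| ≤ ε) :
    ∀ p ∈ closure R, ∀ q ∈ closure R, |dist p.1 q.1 - dist p.2 q.2| ≤ ε := by
  have hcl : IsClosed {P : (X × Y) × (X × Y) | |dist P.1.1 P.2.1 - dist P.1.2 P.2.2| ≤ ε} :=
    isClosed_le (by fun_prop) (by fun_prop)
  have hsub : R ×ˢ R ⊆ {P : (X × Y) × (X × Y) | |dist P.1.1 P.2.1 - dist P.1.2 P.2.2| ≤ ε} :=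
    fun P hP => h _ hP.1 _ hP.2
  intro p hp q hq
  have := hcl.closure_subset_iff.2 hsub
  rw [closure_prod_eq] at this
  exact this (Set.mk_mem_prod hp hq)

namespace IsCoupling

variable {T T' : WeightedTree} {R : Set (T × T')} {m : Measure (T × T')} {ε : ℝ}

theorem nonneg (h : IsCoupling R m ε) : 0 ≤ ε :=
  (abs_nonneg _).trans (h.abs_sub_le _ h.root_mem _ h.root_mem)

theorem isFiniteMeasure (h : IsCoupling R m ε) : IsFiniteMeasure m := by
  refine ⟨?_⟩
  have h1 := h.map_fst_le Set.univ
  rw [Measure.map_apply measurable_fst MeasurableSet.univ, Set.preimage_univ] at h1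
  exact h1.trans_lt (measure_lt_top _ _)

/-- The distortion bound is a closed condition. Closed correspondences are measurable and, by
compactness, have closed compositions. -/
theorem closure (h : IsCoupling R m ε) : IsCoupling (closure R) m ε where
  root_mem := subset_closure h.root_mem
  exists_right x := (h.exists_right x).imp fun _ hx => subset_closure hx
  exists_left x := (h.exists_left x).imp fun _ hx => subset_closure hx
  abs_sub_le := abs_dist_sub_le_of_mem_closure h.abs_sub_le
  null := measure_mono_null (Set.compl_subset_compl.2 subset_closure) h.null
  map_fst_le := h.map_fst_le
  map_snd_le := h.map_snd_le
  mass_left := h.mass_left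
  mass_right := h.mass_right

theorem swap (h : IsCoupling R m ε) : IsCoupling (Prod.swap ⁻¹' R) (m.map Prod.swap) ε where
  root_mem := h.root_mem
  exists_right := h.exists_left
  exists_left := h.exists_right
  abs_sub_le p hp q hq := by
    rw [abs_sub_comm]
    exact h.abs_sub_le _ hp _ hq
  null := by
    rw [show Prod.swap = ⇑(MeasurableEquiv.prodComm (α := T) (β := T')) from rfl,
      MeasurableEquiv.map_apply]
    exact h.null
  map_fst_le := by
    rw [Measure.map_map measurable_fst measurable_swap]
    exact h.map_snd_le
  map_snd_le := by
    rw [Measure.map_map measurable_snd measurable_swap]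
    exact h.map_fst_le
  mass_left := by
    rw [measureReal_map_univ m measurable_swap]
    exact h.mass_right
  mass_right := by
    rw [measureReal_map_univ m measurable_swap]
    exact h.mass_left

theorem abs_height_sub_le (h : IsCoupling R m ε) {x : T} {x' : T'} (hx : (x, x') ∈ R) :
    |T.height x - T'.height x'| ≤ ε :=
  h.abs_sub_le _ h.root_mem _ hx

/-- The product is half a signed sum of three distances, each moved by at most ε; 3ε/2 is rounded up
to 2ε. -/
theorem abs_gromovProd_sub_le (h : IsCoupling R m ε) {x z : T} {x' z' : T'} (hx : (x, x') ∈ R)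
    (hz : (z, z') ∈ R) : |T.gromovProd x z - T'.gromovProd x' z'| ≤ 2 * ε := by
  have h1 := abs_le.1 (h.abs_height_sub_le hx)
  have h2 := abs_le.1 (h.abs_height_sub_le hz)
  have h3 := abs_le.1 (h.abs_sub_le _ hx _ hz)
  have := h.nonneg
  dsimp only at h3
  unfold WeightedTree.gromovProd
  rw [abs_le]
  constructor <;> linarith

/-- The glued measure loses at most the sum of the two mass defects, because the gluing inequality
compares its mass with m + m' - μ₂. -/
theorem comp {T₁ T₂ T₃ : WeightedTree} {R : Set (T₁ × T₂)} {R' : Set (T₂ × T₃)}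
    {m : Measure (T₁ × T₂)} {m' : Measure (T₂ × T₃)} {ε ε' : ℝ} (h : IsCoupling R m ε)
    (h' : IsCoupling R' m' ε') : Close (ε + ε') T₁ T₃ := by
  have hc := h.closure
  have hc' := h'.closure
  set A := _root_.closure R
  set A' := _root_.closure R'
  have hA : IsClosed A := isClosed_closure
  have hA' : IsClosed A' := isClosed_closure
  have := h.isFiniteMeasure
  have := h'.isFiniteMeasure
  have : Nonempty T₁ := ⟨T₁.root⟩
  have : Nonempty T₃ := ⟨T₃.root⟩
  obtain ⟨M, h1, h2, h3, h4⟩ := exists_gluing m m' T₂.μ h.map_snd_le h'.map_fst_le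
  have hM1 : M.map Prod.fst ≤ T₁.μ := h1.trans h.map_fst_le
  have hM2 : M.map Prod.snd ≤ T₃.μ := h2.trans h'.map_snd_le
  have hMfin : IsFiniteMeasure M := by
    refine ⟨?_⟩
    have h1 := hM1 Set.univ
    rw [Measure.map_apply measurable_fst MeasurableSet.univ, Set.preimage_univ] at h1
    exact h1.trans_lt (measure_lt_top _ _)
  have h3' : m.real Set.univ + m'.real Set.univ ≤ M.real Set.univ + T₂.μ.real Set.univ := by
    simp only [measureReal_def]
    rw [← ENNReal.toReal_add (measure_ne_top _ _) (measure_ne_top _ _),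
      ← ENNReal.toReal_add (measure_ne_top _ _) (measure_ne_top _ _)]
    exact ENNReal.toReal_mono (by finiteness) h3
  have e1 := h.mass_left
  have e2 := h.mass_right
  have e3 := h'.mass_left
  have e4 := h'.mass_right
  -- The composition is the projection of a closed set along the compact factor `T₂`.
  have hW : IsClosed {q : T₁ × T₃ | ∃ y, (q.1, y) ∈ A ∧ (y, q.2) ∈ A'} := by
    have : {q : T₁ × T₃ | ∃ y, (q.1, y) ∈ A ∧ (y, q.2) ∈ A'} =
        Prod.fst '' {q : (T₁ × T₃) × T₂ | (q.1.1, q.2) ∈ A ∧ (q.2, q.1.2) ∈ A'} := by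
      ext q
      constructor
      · rintro ⟨y, hy⟩
        exact ⟨(q, y), hy, rfl⟩
      · rintro ⟨⟨q, y⟩, hy, rfl⟩
        exact ⟨y, hy⟩
    rw [this]
    refine isClosedMap_fst_of_compactSpace _ (IsClosed.inter ?_ ?_)
    · exact hA.preimage (by fun_prop : Continuous fun q : (T₁ × T₃) × T₂ => (q.1.1, q.2))
    · exact hA'.preimage (by fun_prop : Continuous fun q : (T₁ × T₃) × T₂ => (q.2, q.1.2))
  refine ⟨{q | ∃ y, (q.1, y) ∈ A ∧ (y, q.2) ∈ A'}, M, ?_, ?_, ?_, ?_, ?_, hM1, hM2, ?_, ?_⟩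
  · exact ⟨T₂.root, hc.root_mem, hc'.root_mem⟩
  · intro x
    obtain ⟨y, hy⟩ := hc.exists_right x
    obtain ⟨z, hz⟩ := hc'.exists_right y
    exact ⟨z, y, hy, hz⟩
  · intro z
    obtain ⟨y, hy⟩ := hc'.exists_left z
    obtain ⟨x, hx⟩ := hc.exists_left y
    exact ⟨x, y, hx, hy⟩
  · rintro ⟨x, z⟩ ⟨y, hxy, hyz⟩ ⟨u, w⟩ ⟨v, huv, hvw⟩
    have k1 := hc.abs_sub_le _ hxy _ huv
    have k2 := hc'.abs_sub_le _ hyz _ hvw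
    exact (_root_.abs_sub_le _ (dist y v) _).trans (add_le_add k1 k2)
  · refine h4 Aᶜ A'ᶜ _ hA.measurableSet.compl hA'.measurableSet.compl hW.measurableSet.compl
      hc.null hc'.null ?_
    intro x y z hxz
    by_contra hcon
    push Not at hcon
    exact hxz ⟨y, not_not.1 hcon.1, not_not.1 hcon.2⟩
  · linarith
  · linarith

end IsCoupling

namespace Close

variable {T T' T'' : WeightedTree} {ε δ : ℝ}

theorem nonneg (h : Close ε T T') : 0 ≤ ε := by
  obtain ⟨R, m, h⟩ := h
  exact h.nonneg

theorem symm (h : Close ε T T') : Close ε T' T := by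
  obtain ⟨R, m, h⟩ := h
  exact ⟨_, _, h.swap⟩

theorem trans (h : Close ε T T') (h' : Close δ T' T'') : Close (ε + δ) T T'' := by
  obtain ⟨R, m, h⟩ := h
  obtain ⟨R', m', h'⟩ := h'
  exact h.comp h'

end Close

theorem Equivalent.isCoupling {T T' : WeightedTree} {e : T ≃ᵢ T'} (h : e T.root = T'.root)
    (hμ : T.μ.map e = T'.μ) :
    IsCoupling {p : T × T' | e p.1 = p.2} (T.μ.map fun x => (x, e x)) 0 := by
  have hm : Measurable fun x : T => (x, e x) := measurable_id.prodMk e.continuous.measurable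
  have hmass : T'.μ.real Set.univ = T.μ.real Set.univ := by
    rw [← hμ, measureReal_map_univ _ e.continuous.measurable]
  refine ⟨h, fun x => ⟨e x, rfl⟩, fun x => ⟨e.symm x, e.apply_symm_apply x⟩, ?_, ?_, ?_, ?_, ?_, ?_⟩
  · rintro ⟨x, x'⟩ (rfl : e x = x') ⟨y, y'⟩ (rfl : e y = y')
    simp [e.dist_eq]
  · have hcl : IsClosed {p : T × T' | e p.1 = p.2} :=
      isClosed_eq (e.continuous.comp continuous_fst) continuous_snd
    rw [Measure.map_apply hm hcl.measurableSet.compl]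
    simp
  · rw [Measure.map_map measurable_fst hm]
    exact (Measure.map_id (μ := T.μ)).le
  · rw [Measure.map_map measurable_snd hm]
    exact hμ.le
  · rw [measureReal_map_univ _ hm, add_zero]
  · rw [measureReal_map_univ _ hm, add_zero, hmass]

theorem Equivalent.close {T T' : WeightedTree} (h : Equivalent T T') : Close 0 T T' := by
  obtain ⟨e, h1, h2⟩ := h
  exact ⟨_, _, Equivalent.isCoupling h1 h2⟩

theorem bddAbove_distortion {T T' : WeightedTree} (R : Set (T × T')) :
    BddAbove {c | ∃ p ∈ R, ∃ q ∈ R, c = |dist p.1 q.1 - dist p.2 q.2|} := by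
  have hc : Continuous fun P : (T × T') × (T × T') => |dist P.1.1 P.2.1 - dist P.1.2 P.2.2| := by
    fun_prop
  obtain ⟨K, hK⟩ := isCompact_univ.bddAbove_image hc.continuousOn
  refine ⟨K, ?_⟩
  rintro c ⟨p, -, q, -, rfl⟩
  exact hK ⟨(p, q), trivial, rfl⟩

theorem nonneg_of_mem_ghpValues {T T' : WeightedTree} {c : ℝ} (hc : c ∈ ghpValues T T') :
    0 ≤ c := by
  obtain ⟨R, m, -, -, -, rfl⟩ := hc
  exact le_max_of_le_right measureReal_nonneg

theorem ghpValues_nonempty (T T' : WeightedTree) : (ghpValues T T').Nonempty := by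
  refine ⟨_, Set.univ, 0, inferInstance, ⟨?_, ?_⟩, trivial, rfl⟩
  · exact Set.eq_univ_of_forall fun x => ⟨(x, T'.root), trivial, rfl⟩
  · exact Set.eq_univ_of_forall fun x => ⟨(T.root, x), trivial, rfl⟩

/-- Domination turns each mass defect ε into a total variation at most ε/2, so the discrepancy is at
most ε. -/
theorem Close.ghpDist_le {T T' : WeightedTree} {ε : ℝ} (h : Close ε T T') :
    ghpDist T T' ≤ ε := by
  obtain ⟨R, m, h⟩ := h
  have := h.isFiniteMeasure
  have hε := h.nonneg
  refine (csInf_le ⟨0, fun c hc => nonneg_of_mem_ghpValues hc⟩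
    ⟨R, m, h.isFiniteMeasure, ⟨?_, ?_⟩, h.root_mem, rfl⟩).trans (max_le (max_le ?_ ?_) ?_)
  · refine Set.eq_univ_of_forall fun x => ?_
    obtain ⟨x', hx⟩ := h.exists_right x
    exact ⟨_, hx, rfl⟩
  · refine Set.eq_univ_of_forall fun x => ?_
    obtain ⟨x', hx⟩ := h.exists_left x
    exact ⟨_, hx, rfl⟩
  · have : distortion R ≤ ε := by
      refine csSup_le ⟨_, _, h.root_mem, _, h.root_mem, rfl⟩ ?_
      rintro c ⟨p, hp, q, hq, rfl⟩
      exact h.abs_sub_le p hp q hq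
    linarith
  · have h1 : tvDist (m.map Prod.fst) T.μ ≤ ε / 2 := by
      refine tvDist_le_of_le h.map_fst_le ?_
      rw [measureReal_map_univ _ measurable_fst]
      exact h.mass_left
    have h2 : tvDist (m.map Prod.snd) T'.μ ≤ ε / 2 := by
      refine tvDist_le_of_le h.map_snd_le ?_
      rw [measureReal_map_univ _ measurable_snd]
      exact h.mass_right
    unfold discrepancy
    linarith
  · rw [measureReal_def, h.null]
    simpa using hε

theorem withDensity_map_le {X Y : Type*} [MeasurableSpace X] [MeasurableSpace Y]
    {m : Measure X} {f : X → Y} (hf : Measurable f) {g : Y → ℝ≥0∞} (hg : Measurable g)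
    {k : X → ℝ≥0∞} (hk : ∀ x, k x ≤ g (f x)) :
    (m.withDensity k).map f ≤ (m.map f).withDensity g := by
  refine Measure.le_iff.2 fun A hA => ?_
  rw [Measure.map_apply hf hA, withDensity_apply _ (hf hA), withDensity_apply _ hA,
    setLIntegral_map hA hg hf]
  exact lintegral_mono fun x => hk x

/-- The measure is cut down by one density for each marginal and restricted to the closure of `R`.
This costs at most 3ε of mass, and the masses of `m` and of the trees differ by at most 2ε; the
distortion is below 2ε. The constant 7 is not sharp. -/
theorem close_of_ghpDist_lt {T T' : WeightedTree} {ε : ℝ} (h : ghpDist T T' < ε) :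
    Close (7 * ε) T T' := by
  obtain ⟨c, ⟨R, m, hm, hR, hroot, rfl⟩, hc⟩ := exists_lt_of_csInf_lt (ghpValues_nonempty T T') h
  have hdis : (1 / 2) * distortion R < ε := (le_max_left _ _).trans_lt
    ((le_max_left _ _).trans_lt hc)
  have hD : discrepancy m T.μ T'.μ < ε := (le_max_right _ _).trans_lt
    ((le_max_left _ _).trans_lt hc)
  have hmass : m.real Rᶜ < ε := (le_max_right _ _).trans_lt hc
  have hε : 0 ≤ ε := measureReal_nonneg.trans hmass.le
  have hn1 := tvDist_nonneg (m.map Prod.fst) T.μ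
  have hn2 := tvDist_nonneg (m.map Prod.snd) T'.μ
  unfold discrepancy at hD
  obtain ⟨g, hg, hg1, hgle, hgi⟩ := exists_density_le (m.map Prod.fst) T.μ
  obtain ⟨k, hk, hk1, hkle, hki⟩ := exists_density_le (m.map Prod.snd) T'.μ
  rw [lintegral_map (f := fun x => 1 - g x) (measurable_const.sub hg) measurable_fst] at hgi
  rw [lintegral_map (f := fun x => 1 - k x) (measurable_const.sub hk) measurable_snd] at hki
  set w : T × T' → ℝ≥0∞ := fun p => g p.1 * k p.2
  have hw : Measurable w := (hg.comp measurable_fst).mul (hk.comp measurable_snd)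
  have hcl : MeasurableSet (closure R) := isClosed_closure.measurableSet
  set m' := (m.withDensity w).restrict (closure R)
  have hm'1 : m'.map Prod.fst ≤ T.μ :=
    (Measure.map_mono Measure.restrict_le_self measurable_fst).trans
      ((withDensity_map_le measurable_fst hg fun p => mul_le_of_le_one_right' (hk1 _)).trans hgle)
  have hm'2 : m'.map Prod.snd ≤ T'.μ :=
    (Measure.map_mono Measure.restrict_le_self measurable_snd).trans
      ((withDensity_map_le measurable_snd hk fun p => mul_le_of_le_one_left' (hg1 _)).trans hkle)
  have hm'fin : IsFiniteMeasure m' := by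
    refine ⟨?_⟩
    have h1 := hm'1 Set.univ
    rw [Measure.map_apply measurable_fst MeasurableSet.univ, Set.preimage_univ] at h1
    exact h1.trans_lt (measure_lt_top _ _)
  have key : m Set.univ ≤ m' Set.univ + m Rᶜ +
      ENNReal.ofReal (2 * tvDist (m.map Prod.fst) T.μ) +
      ENNReal.ofReal (2 * tvDist (m.map Prod.snd) T'.μ) := by
    have e1 : m' Set.univ = ∫⁻ p in closure R, w p ∂m := by
      rw [Measure.restrict_apply MeasurableSet.univ, Set.univ_inter, withDensity_apply _ hcl]
    have e2 : m (closure R) ≤ (∫⁻ p in closure R, w p ∂m) + (∫⁻ p, (1 - g p.1) ∂m) +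
        ∫⁻ p, (1 - k p.2) ∂m := by
      calc m (closure R) = ∫⁻ _ in closure R, 1 ∂m := by rw [setLIntegral_one]
        _ ≤ ∫⁻ p in closure R, (w p + (1 - g p.1) + (1 - k p.2)) ∂m := by
          refine lintegral_mono fun p => ?_
          have h1 := hg1 p.1
          have h2 := hk1 p.2
          -- This is (1 - g)(1 - k) ≥ 0.
          change 1 ≤ g p.1 * k p.2 + (1 - g p.1) + (1 - k p.2)
          lift g p.1 to ℝ≥0 using ne_top_of_le_ne_top ENNReal.one_ne_top h1 with s
          lift k p.2 to ℝ≥0 using ne_top_of_le_ne_top ENNReal.one_ne_top h2 with t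
          norm_cast at h1 h2 ⊢
          rw [← NNReal.coe_le_coe]
          push_cast [NNReal.coe_sub h1, NNReal.coe_sub h2]
          rw [← NNReal.coe_le_coe] at h1 h2
          push_cast at h1 h2
          nlinarith
        _ = (∫⁻ p in closure R, w p ∂m) + (∫⁻ p in closure R, (1 - g p.1) ∂m) +
            ∫⁻ p in closure R, (1 - k p.2) ∂m := by
          rw [lintegral_add_right (g := fun p : T × T' => 1 - k p.2) _
              (measurable_const.sub (hk.comp measurable_snd)),
            lintegral_add_right (g := fun p : T × T' => 1 - g p.1) _
              (measurable_const.sub (hg.comp measurable_fst))]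
        _ ≤ _ := by
          gcongr <;> exact Measure.restrict_le_self
    have e3 : m (closure R)ᶜ ≤ m Rᶜ :=
      measure_mono (Set.compl_subset_compl.2 subset_closure)
    rw [e1, ← measure_add_measure_compl hcl]
    calc _ ≤ ((∫⁻ p in closure R, w p ∂m) + ENNReal.ofReal (2 * tvDist (m.map Prod.fst) T.μ) +
          ENNReal.ofReal (2 * tvDist (m.map Prod.snd) T'.μ)) + m Rᶜ := by
          refine add_le_add (e2.trans ?_) e3
          gcongr
      _ = _ := by ring
  have key' : m.real Set.univ ≤ m'.real Set.univ + m.real Rᶜ +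
      2 * tvDist (m.map Prod.fst) T.μ + 2 * tvDist (m.map Prod.snd) T'.μ := by
    have := ENNReal.toReal_mono (by finiteness) key
    rw [ENNReal.toReal_add (by finiteness) (by finiteness),
      ENNReal.toReal_add (by finiteness) (by finiteness),
      ENNReal.toReal_add (by finiteness) (by finiteness),
      ENNReal.toReal_ofReal (by positivity), ENNReal.toReal_ofReal (by positivity)] at this
    exact this
  have k1 := (abs_le.1 (abs_measureReal_sub_le_tvDist (m.map Prod.fst) T.μ MeasurableSet.univ)).1
  have k2 := (abs_le.1 (abs_measureReal_sub_le_tvDist (m.map Prod.snd) T'.μ MeasurableSet.univ)).1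
  rw [measureReal_map_univ _ measurable_fst] at k1
  rw [measureReal_map_univ _ measurable_snd] at k2
  have hexr : ∀ x, ∃ x', (x, x') ∈ R := by
    intro x
    have : x ∈ Prod.fst '' R := by rw [hR.1]; trivial
    obtain ⟨⟨u, x'⟩, hx, rfl⟩ := this
    exact ⟨x', hx⟩
  have hexl : ∀ x', ∃ x, (x, x') ∈ R := by
    intro x
    have : x ∈ Prod.snd '' R := by rw [hR.2]; trivial
    obtain ⟨⟨x', u⟩, hx, rfl⟩ := this
    exact ⟨x', hx⟩
  refine ⟨closure R, m', subset_closure hroot,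
    fun x => (hexr x).imp fun _ hx => subset_closure hx,
    fun x => (hexl x).imp fun _ hx => subset_closure hx,
    abs_dist_sub_le_of_mem_closure fun p hp q hq => ?_, ?_, hm'1, hm'2, ?_, ?_⟩
  · have : |dist p.1 q.1 - dist p.2 q.2| ≤ distortion R :=
      le_csSup (bddAbove_distortion R) ⟨p, hp, q, hq, rfl⟩
    linarith
  · rw [Measure.restrict_apply hcl.compl, Set.compl_inter_self, measure_empty]
  · linarith
  · linarith

/-! ### A pseudometric for the Gromov-Hausdorff-Prokhorov topology -/

/-- The infimum of the `ε` for which an `ε`-coupling exists. -/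
noncomputable def closeDist (T T' : WeightedTree) : ℝ := sInf {ε | Close ε T T'}

theorem closeDist_le {T T' : WeightedTree} {ε : ℝ} (h : Close ε T T') : closeDist T T' ≤ ε :=
  csInf_le ⟨0, fun _ h => h.nonneg⟩ h

theorem setOf_close_nonempty (T T' : WeightedTree) : {ε | Close ε T T'}.Nonempty :=
  ⟨_, close_of_ghpDist_lt (lt_add_one (ghpDist T T'))⟩

theorem exists_close_lt {T T' : WeightedTree} {ε : ℝ} (h : closeDist T T' < ε) :
    ∃ δ < ε, Close δ T T' := by
  obtain ⟨δ, h1, h2⟩ := exists_lt_of_csInf_lt (setOf_close_nonempty T T') h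
  exact ⟨δ, h2, h1⟩

theorem closeDist_nonneg (T T' : WeightedTree) : 0 ≤ closeDist T T' :=
  Real.sInf_nonneg fun _ h => Close.nonneg h

theorem Equivalent.closeDist_eq_zero {T T' : WeightedTree} (h : Equivalent T T') :
    closeDist T T' = 0 :=
  le_antisymm (closeDist_le h.close) (closeDist_nonneg _ _)

theorem ghpDist_le_closeDist (T T' : WeightedTree) : ghpDist T T' ≤ closeDist T T' := by
  refine le_of_forall_gt fun ε hε => ?_
  obtain ⟨δ, h1, h2⟩ := exists_close_lt hε
  exact h2.ghpDist_le.trans_lt h1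

noncomputable instance : PseudoMetricSpace WeightedTree where
  dist := closeDist
  dist_self T := (equivalence_equivalent.refl T).closeDist_eq_zero
  dist_comm T T' := congrArg sInf (Set.ext fun _ => ⟨Close.symm, Close.symm⟩)
  dist_triangle T T' T'' := by
    refine le_of_forall_pos_lt_add fun ε hε => ?_
    obtain ⟨a, h1, h2⟩ := exists_close_lt (lt_add_of_pos_right (closeDist T T') (half_pos hε))
    obtain ⟨b, h3, h4⟩ := exists_close_lt (lt_add_of_pos_right (closeDist T' T'') (half_pos hε))
    refine (closeDist_le (h2.trans h4)).trans_lt ?_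
    linarith

theorem WeightedTree.dist_eq (T T' : WeightedTree) : dist T T' = closeDist T T' := rfl

theorem Equivalent.dist_congr {T₁ T₂ S₁ S₂ : WeightedTree} (h₁ : Equivalent T₁ S₁)
    (h₂ : Equivalent T₂ S₂) : dist T₁ T₂ = dist S₁ S₂ := by
  have e1 : dist T₁ S₁ = 0 := h₁.closeDist_eq_zero
  have e2 : dist T₂ S₂ = 0 := h₂.closeDist_eq_zero
  have t1 := dist_triangle4 T₁ S₁ S₂ T₂
  have t2 := dist_triangle4 S₁ T₁ T₂ S₂
  rw [dist_comm S₁ T₁] at t2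
  rw [dist_comm S₂ T₂] at t1
  linarith

/-- A representative of an isometry class. -/
noncomputable def TreeSpace.out (t : TreeSpace) : WeightedTree := Quotient.out (s := treeSetoid) t

theorem TreeSpace.toTreeSpace_out (t : TreeSpace) : t.out.toTreeSpace = t := Quotient.out_eq t

theorem equivalent_out (T : WeightedTree) : Equivalent T.toTreeSpace.out T :=
  Quotient.mk_out T

theorem TreeSpace.ghpDist_eq (t t' : TreeSpace) :
    t.ghpDist t' = RealTrees.ghpDist t.out t'.out := by
  conv_lhs => rw [← t.toTreeSpace_out, ← t'.toTreeSpace_out]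
  rfl

/-- `replaceTopology` keeps the given GHP topology definitionally. A pseudometric suffices: distance
zero is never shown to imply equality of classes. -/
noncomputable instance : PseudoMetricSpace TreeSpace :=
  PseudoMetricSpace.replaceTopology
    (PseudoMetricSpace.induced TreeSpace.out inferInstance) (by
      refine TopologicalSpace.ext_iff.2 fun U => ?_
      refine Iff.trans ?_ (@Metric.isOpen_iff _
        (PseudoMetricSpace.induced TreeSpace.out inferInstance) U).symm
      refine forall₂_congr fun t _ => ?_
      constructor
      · rintro ⟨ε, hε, h⟩
        refine ⟨ε, hε, fun t' ht' => h t' ?_⟩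
        rw [TreeSpace.ghpDist_eq]
        refine (ghpDist_le_closeDist _ _).trans_lt ?_
        rw [← WeightedTree.dist_eq, dist_comm]
        exact ht'
      · rintro ⟨ε, hε, h⟩
        -- `close_of_ghpDist_lt` costs a factor 7, and 7/8 < 1.
        refine ⟨ε / 8, by positivity, fun t' ht' => h ?_⟩
        rw [TreeSpace.ghpDist_eq] at ht'
        have := closeDist_le (close_of_ghpDist_lt ht')
        change dist t'.out t.out < ε
        rw [dist_comm, WeightedTree.dist_eq]
        linarith)

theorem dist_toTreeSpace (T T' : WeightedTree) :
    dist T.toTreeSpace T'.toTreeSpace = closeDist T T' :=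
  (equivalent_out T).dist_congr (equivalent_out T')

end RealTrees

/-! ### Closeness of subtrees, across a coupling and along one ancestral line. -/

namespace RealTrees

namespace IsCoupling

variable {T T' : WeightedTree} {R : Set (T × T')} {m : Measure (T × T')} {ε : ℝ}

theorem measureReal_fst_le (h : IsCoupling R m ε) {A : Set T} (hA : MeasurableSet A) :
    m.real (Prod.fst ⁻¹' A) ≤ T.μ.real A := by
  have h1 := h.map_fst_le A
  rw [Measure.map_apply measurable_fst hA] at h1
  exact ENNReal.toReal_mono (measure_ne_top _ _) h1

/-- The defect of the marginal is nonnegative on the complement of `A` and at most ε in total. -/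
theorem measureReal_le_fst (h : IsCoupling R m ε) {A : Set T} (hA : MeasurableSet A) :
    T.μ.real A ≤ m.real (Prod.fst ⁻¹' A) + ε := by
  have := h.isFiniteMeasure
  have h1 := h.measureReal_fst_le hA.compl
  have h2 := h.mass_left
  rw [← measureReal_add_measureReal_compl hA,
    ← measureReal_add_measureReal_compl (measurable_fst hA : MeasurableSet (Prod.fst ⁻¹' A))] at h2
  rw [Set.preimage_compl] at h1
  linarith

theorem measureReal_le_snd (h : IsCoupling R m ε) {A : Set T'} (hA : MeasurableSet A) :
    T'.μ.real A ≤ m.real (Prod.snd ⁻¹' A) + ε := by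
  have := h.swap.measureReal_le_fst hA
  rwa [map_measureReal_apply measurable_swap (measurable_fst hA), ← Set.preimage_comp] at this

/-- Restricting a coupling to closed subtrees that correspond to each other outside a set of small
measure located near the root. -/
theorem close_of_isometry (h : IsCoupling R m ε) {S S' : WeightedTree} {i : S → T} {i' : S' → T'}
    (hi : Isometry i) (hi' : Isometry i') (hμ : S.μ = T.μ.comap i) (hμ' : S'.μ = T'.μ.comap i')
    {N : Set T} (hN : MeasurableSet N) {δ : ℝ} (hNμ : T.μ.real N ≤ δ)
    (hNball : ∀ z ∈ N, dist z (i S.root) ≤ δ)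
    (hiff : ∀ p ∈ R, p.1 ∉ N → (p.1 ∈ Set.range i ↔ p.2 ∈ Set.range i')) {w : T × T'}
    (hw : w ∈ R) (hw1 : dist (i S.root) w.1 ≤ δ) (hw2 : dist (i' S'.root) w.2 ≤ δ) :
    Close (ε + 8 * δ) S S' := by
  have := h.isFiniteMeasure
  have hδ : 0 ≤ δ := dist_nonneg.trans hw1
  have hε := h.nonneg
  have hei : MeasurableEmbedding i := hi.isClosedEmbedding.measurableEmbedding
  have hei' : MeasurableEmbedding i' := hi'.isClosedEmbedding.measurableEmbedding
  have hj : MeasurableEmbedding (Prod.map i i') := hei.prodMap hei'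
  have hrj : Set.range (Prod.map i i') = Set.range i ×ˢ Set.range i' := Set.range_prodMap
  have hbad : ∀ p ∈ R, ¬ (p.1 ∈ Set.range i ↔ p.2 ∈ Set.range i') → p.1 ∈ N := fun p hp hn => by
    by_contra hcon
    exact hn (hiff p hp hcon)
  have hmass : (m.comap (Prod.map i i')).real Set.univ =
      m.real (Set.range i ×ˢ Set.range i') := by
    rw [measureReal_def, hj.comap_apply, Set.image_univ, hrj, measureReal_def]
  have hRm : m.real Rᶜ = 0 := by rw [measureReal_def, h.null, ENNReal.toReal_zero]
  have hNm : m.real (Prod.fst ⁻¹' N) ≤ δ := (h.measureReal_fst_le hN).trans hNμ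
  -- A point whose partner falls outside the other subtree is matched with the other root. Such
  -- pairs are within 2δ of `R`, through `w` or through `N`; moving four endpoints by 2δ adds 8δ to
  -- the distortion.
  refine ⟨{p | ∃ q ∈ R, dist (i p.1) q.1 ≤ 2 * δ ∧ dist (i' p.2) q.2 ≤ 2 * δ},
    m.comap (Prod.map i i'), ?_, ?_, ?_, ?_, ?_, ?_, ?_, ?_, ?_⟩
  · exact ⟨w, hw, by linarith, by linarith⟩
  · intro z
    obtain ⟨z', hz⟩ := h.exists_right (i z)
    by_cases hz' : z' ∈ Set.range i'
    · obtain ⟨u, rfl⟩ := hz'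
      exact ⟨u, _, hz, by simpa using hδ, by simpa using hδ⟩
    · have h1 := hNball _ (hbad _ hz fun hcon => hz' (hcon.1 ⟨z, rfl⟩))
      have h2 := dist_triangle (i z) (i S.root) w.1
      exact ⟨S'.root, w, hw, by dsimp only at *; linarith, by linarith⟩
  · intro z'
    obtain ⟨z, hz⟩ := h.exists_left (i' z')
    by_cases hz' : z ∈ Set.range i
    · obtain ⟨u, rfl⟩ := hz'
      exact ⟨u, _, hz, by simpa using hδ, by simpa using hδ⟩
    · have h1 := hNball _ (hbad _ hz fun hcon => hz' (hcon.2 ⟨z', rfl⟩))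
      rw [dist_comm] at h1
      exact ⟨S.root, _, hz, by dsimp only at *; linarith, by simpa using hδ⟩
  · rintro p ⟨q, hq, h1, h2⟩ p' ⟨q', hq', h3, h4⟩
    have k := abs_le.1 (h.abs_sub_le _ hq _ hq')
    have t1 := dist_triangle4 (i p.1) q.1 q'.1 (i p'.1)
    have t2 := dist_triangle4 q.1 (i p.1) (i p'.1) q'.1
    have t3 := dist_triangle4 (i' p.2) q.2 q'.2 (i' p'.2)
    have t4 := dist_triangle4 q.2 (i' p.2) (i' p'.2) q'.2
    rw [dist_comm q'.1] at t1
    rw [dist_comm q.1 (i p.1)] at t2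
    rw [dist_comm q'.2] at t3
    rw [dist_comm q.2 (i' p.2)] at t4
    rw [hi.dist_eq] at t1 t2
    rw [hi'.dist_eq] at t3 t4
    rw [abs_le]
    constructor <;> linarith
  · rw [hj.comap_apply]
    refine measure_mono_null ?_ h.null
    rintro - ⟨p, hp, rfl⟩ hR
    exact hp ⟨_, hR, by simpa using hδ, by simpa using hδ⟩
  · rw [hμ]
    refine Measure.le_iff.2 fun A hA => ?_
    rw [Measure.map_apply measurable_fst hA, hj.comap_apply, hei.comap_apply]
    refine (measure_mono ?_).trans ((Measure.map_apply measurable_fst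
      (hei.measurableSet_image.2 hA)).symm.le.trans (h.map_fst_le _))
    rintro - ⟨p, hp, rfl⟩
    exact ⟨p.1, hp, rfl⟩
  · rw [hμ']
    refine Measure.le_iff.2 fun A hA => ?_
    rw [Measure.map_apply measurable_snd hA, hj.comap_apply, hei'.comap_apply]
    refine (measure_mono ?_).trans ((Measure.map_apply measurable_snd
      (hei'.measurableSet_image.2 hA)).symm.le.trans (h.map_snd_le _))
    rintro - ⟨p, hp, rfl⟩
    exact ⟨p.2, hp, rfl⟩
  · have e1 : S.μ.real Set.univ = T.μ.real (Set.range i) := by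
      rw [hμ, measureReal_def, hei.comap_apply, Set.image_univ, measureReal_def]
    have e2 : m.real (Prod.fst ⁻¹' Set.range i) ≤
        m.real (Set.range i ×ˢ Set.range i' ∪ Prod.fst ⁻¹' N ∪ Rᶜ) := by
      refine measureReal_mono ?_
      intro p hp
      by_cases hpR : p ∈ R
      · refine Or.inl ?_
        by_cases hp' : p.2 ∈ Set.range i'
        · exact Or.inl ⟨hp, hp'⟩
        · exact Or.inr (hbad p hpR fun hcon => hp' (hcon.1 hp))
      · exact Or.inr hpR
    have e3 := measureReal_union_le (μ := m) (Set.range i ×ˢ Set.range i' ∪ Prod.fst ⁻¹' N) Rᶜ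
    have e4 := measureReal_union_le (μ := m) (Set.range i ×ˢ Set.range i') (Prod.fst ⁻¹' N)
    have e5 := h.measureReal_le_fst hei.measurableSet_range
    rw [e1, hmass]
    linarith
  · have e1 : S'.μ.real Set.univ = T'.μ.real (Set.range i') := by
      rw [hμ', measureReal_def, hei'.comap_apply, Set.image_univ, measureReal_def]
    have e2 : m.real (Prod.snd ⁻¹' Set.range i') ≤
        m.real (Set.range i ×ˢ Set.range i' ∪ Prod.fst ⁻¹' N ∪ Rᶜ) := by
      refine measureReal_mono ?_
      intro p hp
      by_cases hpR : p ∈ R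
      · refine Or.inl ?_
        by_cases hp' : p.1 ∈ Set.range i
        · exact Or.inl ⟨hp', hp⟩
        · exact Or.inr (hbad p hpR fun hcon => hp' (hcon.2 hp))
      · exact Or.inr hpR
    have e3 := measureReal_union_le (μ := m) (Set.range i ×ˢ Set.range i' ∪ Prod.fst ⁻¹' N) Rᶜ
    have e4 := measureReal_union_le (μ := m) (Set.range i ×ˢ Set.range i') (Prod.fst ⁻¹' N)
    have e5 := h.measureReal_le_snd hei'.measurableSet_range
    rw [e1, hmass]
    linarith

theorem close_subtreeAbove (h : IsCoupling R m ε) {y : T} {y' : T'} {N : Set T}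
    (hN : MeasurableSet N) {δ : ℝ} (hNμ : T.μ.real N ≤ δ) (hNball : ∀ z ∈ N, dist z y ≤ δ)
    (hiff : ∀ p ∈ R, p.1 ∉ N → (p.1 ∈ T.above y ↔ p.2 ∈ T'.above y')) {w : T × T'}
    (hw : w ∈ R) (hw1 : dist y w.1 ≤ δ) (hw2 : dist y' w.2 ≤ δ) :
    Close (ε + 8 * δ) (T.subtreeAbove y) (T'.subtreeAbove y') := by
  refine h.close_of_isometry (S := T.subtreeAbove y) (S' := T'.subtreeAbove y')
    (i := fun z : T.above y => (z : T)) (i' := fun z : T'.above y' => (z : T'))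
    (fun _ _ => rfl) (fun _ _ => rfl) rfl rfl hN hNμ hNball (fun p hp hpN => ?_) hw hw1 hw2
  have e1 : p.1 ∈ Set.range (fun z : T.above y => (z : T)) ↔ p.1 ∈ T.above y := by simp
  have e2 : p.2 ∈ Set.range (fun z : T'.above y' => (z : T')) ↔ p.2 ∈ T'.above y' := by simp
  exact e1.trans ((hiff p hp hpN).trans e2.symm)

/-- Subtrees above the same level along corresponding points are close when few points branch off
near that level. -/
theorem close_subtree (h : IsCoupling R m ε) {x : T} {x' : T'} (hx : (x, x') ∈ R) {r : ℝ}
    (h0 : 0 ≤ r) (h1 : r ≤ T.height x) (h1' : r ≤ T'.height x') {δ : ℝ}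
    (hNμ : T.μ.real {z | |T.gromovProd x z - r| ≤ 2 * ε} ≤ δ)
    (hNball : ∀ z, |T.gromovProd x z - r| ≤ 2 * ε → dist z (T.ancestor r x) ≤ δ) :
    Close (17 * ε + 8 * δ) (T.subtree r x) (T'.subtree r x') := by
  have hε := h.nonneg
  have hδ : 0 ≤ δ := measureReal_nonneg.trans hNμ
  -- A partner of x_r nearly has the distances to the root and to x' that characterize x'_r, so it
  -- lies within 2ε of x'_r.
  obtain ⟨w', hw⟩ := h.exists_right (T.ancestor r x)
  have hcl : IsClosed {z | |T.gromovProd x z - r| ≤ 2 * ε} :=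
    isClosed_le ((T.continuous_gromovProd_right x).sub continuous_const).abs continuous_const
  have hw' : dist w' (T'.ancestor r x') ≤ 2 * ε := by
    have a1 := T.height_ancestor h0 h1
    have a2 := T.dist_ancestor h0 h1
    have a3 := abs_le.1 (h.abs_height_sub_le hw)
    have a4 := abs_le.1 (h.abs_sub_le _ hw _ hx)
    have a5 := abs_le.1 (h.abs_height_sub_le hx)
    dsimp only at a4
    exact T'.dist_ancestor_le h0 h1' (by linarith) (by linarith)
  -- The exceptional set is the window of width 2ε around `r`, outside which r ≤ (x|z) and r ≤
  -- (x'|z') are equivalent. The radius δ + 2ε absorbs the mismatch of the two ancestors, whence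
  -- 17ε.
  have := h.close_subtreeAbove (y := T.ancestor r x) (y' := T'.ancestor r x')
    hcl.measurableSet (δ := δ + 2 * ε) (by linarith) (fun z hz => (hNball z hz).trans (by linarith))
    ?_ hw (by simpa using by linarith) (by rw [dist_comm]; dsimp only; linarith)
  · rw [show 17 * ε + 8 * δ = ε + 8 * (δ + 2 * ε) by ring]
    exact this
  · rintro ⟨z, z'⟩ hz hzN
    rw [T.mem_above_ancestor_iff h0 h1, T'.mem_above_ancestor_iff h0 h1']
    have k := abs_le.1 (h.abs_gromovProd_sub_le hx hz)
    have hzN' : 2 * ε < |T.gromovProd x z - r| := not_le.1 hzN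
    dsimp only
    rcases lt_abs.1 hzN' with hlt | hlt <;> constructor <;> intro <;> linarith

end IsCoupling

namespace WeightedTree

variable (T : WeightedTree)

theorem isCoupling_refl : IsCoupling {p : T × T | p.1 = p.2} (T.μ.map fun x => (x, x)) 0 :=
  Equivalent.isCoupling (e := IsometryEquiv.refl T) rfl Measure.map_id

/-- For the diagonal coupling, the two subtrees differ exactly by the points that branch off at
levels in [s, H(y)). -/
theorem close_subtree_self {y : T} {s δ : ℝ} (h0 : 0 ≤ s) (h1 : s ≤ T.height y)
    (hs : T.height y - s ≤ δ)
    (hNμ : T.μ.real {z | s ≤ T.gromovProd y z ∧ T.gromovProd y z < T.height y} ≤ δ)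
    (hNball : ∀ z, s ≤ T.gromovProd y z → T.gromovProd y z < T.height y → dist z y ≤ δ) :
    Close (8 * δ) (T.subtreeAbove y) (T.subtree s y) := by
  have hc := T.continuous_gromovProd_right y
  have hN : MeasurableSet {z | s ≤ T.gromovProd y z ∧ T.gromovProd y z < T.height y} :=
    (isClosed_le continuous_const hc).measurableSet.inter
      (isOpen_lt hc continuous_const).measurableSet
  have := T.isCoupling_refl.close_subtreeAbove (y := y) (y' := T.ancestor s y) hN hNμ
    (fun z hz => hNball z hz.1 hz.2) ?_ (w := (y, y)) rfl
    (by simpa using (sub_nonneg.2 h1).trans hs)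
    (by dsimp only; rw [T.dist_ancestor h0 h1]; exact hs)
  · rwa [zero_add] at this
  · rintro ⟨z, z'⟩ (rfl : z = z') hz
    dsimp only
    rw [T.mem_above_iff_gromovProd, T.mem_above_ancestor_iff h0 h1]
    constructor
    · intro h
      exact h1.trans h
    · intro h
      by_contra hcon
      exact hz ⟨h, not_le.1 hcon⟩

/-- The points that branch off the ancestral line of `y` at a level in `[H(y) - η, H(y))`. -/
def branchingBelow (y : T) (η : ℝ) : Set T :=
  {z | T.height y - η ≤ T.gromovProd y z ∧ T.gromovProd y z < T.height y}

theorem branchingBelow_mono (y : T) {η δ : ℝ} (h : η ≤ δ) :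
    T.branchingBelow y η ⊆ T.branchingBelow y δ :=
  fun _ hz => ⟨le_trans (sub_le_sub_left h _) hz.1, hz.2⟩

theorem measurableSet_branchingBelow (y : T) (η : ℝ) : MeasurableSet (T.branchingBelow y η) :=
  (isClosed_le continuous_const (T.continuous_gromovProd_right y)).measurableSet.inter
    (isOpen_lt (T.continuous_gromovProd_right y) continuous_const).measurableSet

/-- The strict inequality (y|z) < H(y) makes these sets decrease to the empty set. -/
theorem exists_measureReal_branchingBelow_le (y : T) {δ : ℝ} (hδ : 0 < δ) :
    ∃ η > 0, T.μ.real (T.branchingBelow y η) ≤ δ := by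
  have hempty : ⋂ k : ℕ, T.branchingBelow y (1 / ((k : ℝ) + 1)) = ∅ := by
    refine Set.eq_empty_of_forall_notMem fun z hz => ?_
    have hz' := Set.mem_iInter.1 hz
    obtain ⟨k, hk⟩ := exists_nat_one_div_lt (sub_pos.2 (hz' 0).2)
    linarith [(hz' k).1]
  have hlim := tendsto_measure_iInter_atTop (μ := T.μ)
    (fun k : ℕ => (T.measurableSet_branchingBelow y (1 / ((k : ℝ) + 1))).nullMeasurableSet)
    (fun j k hjk => T.branchingBelow_mono y (Nat.one_div_le_one_div hjk)) ⟨0, measure_ne_top _ _⟩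
  rw [hempty, measure_empty] at hlim
  obtain ⟨k, hk⟩ := (hlim.eventually (gt_mem_nhds (ENNReal.ofReal_pos.2 hδ))).exists
  exact ⟨1 / ((k : ℝ) + 1), Nat.one_div_pos_of_nat, ENNReal.toReal_le_of_le_ofReal hδ.le hk.le⟩

/-- A limit of points that branch off the ancestral line of `y` at levels tending to `H(y)` from
below is `y`. -/
theorem eq_of_tendsto_of_gromovProd_lt {y u : T} {z : ℕ → T}
    (hu : Filter.Tendsto z Filter.atTop (nhds u)) (hz : ∀ n, T.gromovProd y (z n) < T.height y)
    (hge : T.height y ≤ T.gromovProd y u) : u = y := by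
  -- The limit `u` descends from `y` while no `z n` does, so their lines separate below `y`. In the
  -- limit this gives H(u) ≤ H(y).
  have hzu : ∀ n, T.gromovProd (z n) u ≤ T.height y := by
    intro n
    have hlt := hz n
    have := T.min_gromovProd_le y u (z n)
    rw [T.gromovProd_comm u] at this
    rcases min_le_iff.1 this with h | h <;> linarith
  have hlim : T.gromovProd u u ≤ T.height y := by
    have h := (T.continuous_gromovProd.tendsto (u, u)).comp (hu.prodMk_nhds tendsto_const_nhds)
    exact le_of_tendsto' h hzu
  have huu : T.gromovProd u u = T.height u := by
    unfold gromovProd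
    simp
  have hyu := T.mem_above_iff.1 (T.mem_above_iff_gromovProd.2 hge)
  have hd : dist y u ≤ 0 := by linarith
  exact (dist_le_zero.1 hd).symm

/-- Otherwise compactness yields a limit of such points at distance at least δ from `y`, which
`eq_of_tendsto_of_gromovProd_lt` excludes. -/
theorem exists_dist_branchingBelow_le (y : T) {δ : ℝ} (hδ : 0 < δ) :
    ∃ η > 0, ∀ z ∈ T.branchingBelow y η, dist z y ≤ δ := by
  by_contra hcon
  push Not at hcon
  have hpos : ∀ k : ℕ, 0 < 1 / ((k : ℝ) + 1) := fun k => Nat.one_div_pos_of_nat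
  choose z hzN hz using fun k : ℕ => hcon (1 / ((k : ℝ) + 1)) (hpos k)
  obtain ⟨u, φ, hφ, hu⟩ := CompactSpace.tendsto_subseq z
  have hg : Filter.Tendsto (fun n => T.gromovProd y (z (φ n))) Filter.atTop
      (nhds (T.gromovProd y u)) := ((T.continuous_gromovProd_right y).tendsto u).comp hu
  have hl : Filter.Tendsto (fun n : ℕ => T.height y - 1 / ((n : ℝ) + 1)) Filter.atTop
      (nhds (T.height y)) := by
    simpa only [sub_zero] using (tendsto_const_nhds (x := T.height y)).sub
      (tendsto_one_div_add_atTop_nhds_zero_nat (𝕜 := ℝ))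
  have hge : T.height y ≤ T.gromovProd y u := le_of_tendsto_of_tendsto' hl hg fun n =>
    (T.branchingBelow_mono y (Nat.one_div_le_one_div (hφ.id_le n)) (hzN (φ n))).1
  have huy := T.eq_of_tendsto_of_gromovProd_lt hu (fun n => (hzN (φ n)).2) hge
  have hle : δ ≤ dist u y := ge_of_tendsto' (hu.dist tendsto_const_nhds) fun n => (hz (φ n)).le
  rw [huy, dist_self] at hle
  exact hle.not_gt hδ

/-- Subtrees above ancestors of `y` converge to the subtree above `y`. -/
theorem tendsto_subtree (y : T) {s : ℕ → ℝ} (h0 : ∀ n, 0 ≤ s n) (h1 : ∀ n, s n ≤ T.height y)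
    (hs : Filter.Tendsto s Filter.atTop (nhds (T.height y))) :
    Filter.Tendsto (fun n => (T.subtree (s n) y).toTreeSpace) Filter.atTop
      (nhds (T.subtreeAbove y).toTreeSpace) := by
  refine Metric.tendsto_atTop.2 fun κ hκ => ?_
  have hδ : 0 < κ / 16 := by positivity
  obtain ⟨η₁, hη₁, hμ⟩ := T.exists_measureReal_branchingBelow_le y hδ
  obtain ⟨η₂, hη₂, hball⟩ := T.exists_dist_branchingBelow_le y hδ
  have hpos : 0 < min (κ / 16) (min η₁ η₂) := lt_min hδ (lt_min hη₁ hη₂)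
  obtain ⟨n₀, hn₀⟩ := Filter.eventually_atTop.1
    (hs.eventually (lt_mem_nhds (sub_lt_self (T.height y) hpos)))
  refine ⟨n₀, fun n hn => ?_⟩
  have h2 := hn₀ n hn
  have h3 := min_le_left (κ / 16) (min η₁ η₂)
  have h4 := (min_le_right (κ / 16) (min η₁ η₂)).trans (min_le_left _ _)
  have h5 := (min_le_right (κ / 16) (min η₁ η₂)).trans (min_le_right _ _)
  have hsub : {z | s n ≤ T.gromovProd y z ∧ T.gromovProd y z < T.height y} ⊆
      T.branchingBelow y η₁ := fun z hz => ⟨by linarith [hz.1], hz.2⟩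
  have := T.close_subtree_self (h0 n) (h1 n) (δ := κ / 16) (by linarith)
    ((measureReal_mono hsub).trans hμ) (fun z hz hz' => hball z ⟨by linarith, hz'⟩)
  rw [dist_comm, dist_toTreeSpace]
  refine (closeDist_le this).trans_lt ?_
  linarith

end WeightedTree

end RealTrees

/-! ### Measurability of subtrees, through countably many grid ancestors. -/

namespace RealTrees

namespace WeightedTree

variable (T : WeightedTree)

/-- At a given level, only countably many vertices have descendants at a given larger height. -/
theorem countable_ancestors {a b : ℝ} (ha : 0 ≤ a) (hab : a < b) :
    {p : T | ∃ y, b ≤ T.height y ∧ T.ancestor a y = p}.Countable := by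
  have hc : ∀ p : T, ∃ y, (∃ y, b ≤ T.height y ∧ T.ancestor a y = p) →
      b ≤ T.height y ∧ T.ancestor a y = p := by
    intro p
    by_cases hp : ∃ y, b ≤ T.height y ∧ T.ancestor a y = p
    · obtain ⟨y, hy⟩ := hp
      exact ⟨y, fun _ => hy⟩
    · exact ⟨p, fun h => absurd h hp⟩
  choose g hg using hc
  refine T.countable_of_separated (sub_pos.2 hab) g fun p hp q hq hpq => ?_
  obtain ⟨h1, h2⟩ := hg p hp
  obtain ⟨h3, h4⟩ := hg q hq
  -- Lines through distinct vertices at level `a` have separated before `a`, so their chosen points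
  -- of height at least `b` are more than 2(b - a) apart.
  have hlt : T.gromovProd (g p) (g q) < a := by
    by_contra hcon
    have h5 := T.mem_above_iff.1 ((T.mem_above_ancestor_iff ha (hab.le.trans h1)).2 (not_lt.1 hcon))
    rw [T.height_ancestor ha (hab.le.trans h1), h2] at h5
    have h6 := T.dist_ancestor_le (x := g q) (w := p) (α := 0) ha (hab.le.trans h3)
      (by rw [← h2, T.height_ancestor ha (hab.le.trans h1), add_zero]) (by linarith)
    rw [h4] at h6
    exact hpq (dist_le_zero.1 h6)
  unfold gromovProd at hlt
  linarith

/-- The largest level of the form `j / (k + 1)` at distance at least `1 / (k + 1)` below `y`, or `0`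
if there is none. -/
noncomputable def gridHeight (k : ℕ) (y : T) : ℝ :=
  ((⌊(k + 1) * T.height y⌋₊ - 1 : ℕ) : ℝ) / (k + 1)

theorem measurable_gridHeight (k : ℕ) : Measurable (T.gridHeight k) := by
  have h1 : Measurable fun y : T => ⌊((k : ℝ) + 1) * T.height y⌋₊ :=
    Nat.measurable_floor.comp (T.continuous_height.measurable.const_mul _)
  have h2 : Measurable fun n : ℕ => (((n - 1 : ℕ) : ℝ)) / ((k : ℝ) + 1) := measurable_from_nat
  exact h2.comp h1

theorem gridHeight_nonneg (k : ℕ) (y : T) : 0 ≤ T.gridHeight k y := by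
  unfold gridHeight
  positivity

theorem gridHeight_le (k : ℕ) (y : T) : T.gridHeight k y ≤ T.height y := by
  have h0 := T.height_nonneg y
  have h1 := Nat.floor_le (a := ((k : ℝ) + 1) * T.height y) (by positivity)
  unfold gridHeight
  rw [div_le_iff₀ (by positivity), mul_comm (T.height y)]
  refine le_trans ?_ h1
  exact_mod_cast Nat.sub_le _ _

theorem height_sub_le_gridHeight (k : ℕ) (y : T) :
    T.height y - 2 / (k + 1) ≤ T.gridHeight k y := by
  have h1 := Nat.lt_floor_add_one (((k : ℝ) + 1) * T.height y)
  have h2 : (⌊((k : ℝ) + 1) * T.height y⌋₊ : ℝ) ≤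
      ((⌊((k : ℝ) + 1) * T.height y⌋₊ - 1 : ℕ) : ℝ) + 1 := by
    exact_mod_cast Nat.le_add_of_sub_le le_rfl
  unfold gridHeight
  rw [le_div_iff₀ (by positivity), sub_mul, div_mul_cancel₀ _ (by positivity), mul_comm (T.height y)]
  linarith

theorem tendsto_gridHeight (y : T) :
    Filter.Tendsto (fun k => T.gridHeight k y) Filter.atTop (nhds (T.height y)) := by
  refine tendsto_of_tendsto_of_tendsto_of_le_of_le (g := fun k : ℕ => T.height y - 2 / ((k : ℝ) + 1))
    ?_ tendsto_const_nhds (T.height_sub_le_gridHeight · y) (T.gridHeight_le · y)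
  have := (tendsto_const_nhds (x := T.height y)).sub
    ((tendsto_one_div_add_atTop_nhds_zero_nat (𝕜 := ℝ)).const_mul 2)
  simpa only [mul_one_div, mul_zero, sub_zero] using this

/-- The subtracted 1 in `gridHeight` leaves a full grid step between the ancestor and `y`, the gap
that `countable_ancestors` needs. -/
theorem countable_range_gridAncestor (k : ℕ) :
    (Set.range fun y => T.ancestor (T.gridHeight k y) y).Countable := by
  have hc : (⋃ j : ℕ, {p : T | ∃ y, ((j : ℝ) + 1) / (k + 1) ≤ T.height y ∧
      T.ancestor ((j : ℝ) / (k + 1)) y = p}).Countable :=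
    Set.countable_iUnion fun j => T.countable_ancestors (by positivity)
      (by gcongr; linarith)
  refine (hc.union (Set.countable_singleton T.root)).mono ?_
  rintro - ⟨y, rfl⟩
  dsimp only
  -- When the floor is 0, truncated subtraction gives level 0 and the ancestor is the root.
  rcases Nat.eq_zero_or_pos ⌊((k : ℝ) + 1) * T.height y⌋₊ with h | h
  · refine Or.inr ?_
    have h1 : T.gridHeight k y = 0 := by
      unfold gridHeight
      rw [h]
      simp
    have := T.height_ancestor (le_refl 0) (T.height_nonneg y)
    rw [h1]
    exact (dist_eq_zero.1 this).symm
  · refine Or.inl (Set.mem_iUnion.2 ⟨⌊((k : ℝ) + 1) * T.height y⌋₊ - 1, y, ?_, rfl⟩)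
    have h1 := Nat.floor_le (a := ((k : ℝ) + 1) * T.height y)
      (mul_nonneg (by positivity) (T.height_nonneg y))
    rw [div_le_iff₀ (by positivity), mul_comm (T.height y)]
    refine le_trans ?_ h1
    exact_mod_cast (Nat.sub_add_cancel h).le

theorem measurable_comp_of_countable_range {α β γ : Type*} [MeasurableSpace α] [MeasurableSpace β]
    [MeasurableSingletonClass β] [MeasurableSpace γ] {f : α → β} (hf : Measurable f)
    (hc : (Set.range f).Countable) (F : β → γ) : Measurable (F ∘ f) := by
  intro s _
  have : F ∘ f ⁻¹' s = f ⁻¹' (Set.range f ∩ F ⁻¹' s) := by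
    ext x
    simp
  rw [this]
  exact hf (hc.mono Set.inter_subset_left).measurableSet

/-- The map need not be continuous, but it is the pointwise limit from below of maps that factor
through countably many vertices. -/
theorem measurable_subtreeAbove : Measurable fun y : T => (T.subtreeAbove y).toTreeSpace := by
  refine measurable_of_tendsto_metrizable
    (f := fun k y => (T.subtree (T.gridHeight k y) y).toTreeSpace) (fun k => ?_) ?_
  · refine measurable_comp_of_countable_range ?_ (T.countable_range_gridAncestor k)
      fun y => (T.subtreeAbove y).toTreeSpace
    exact T.continuous_ancestor.measurable.comp ((T.measurable_gridHeight k).prodMk measurable_id)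
  · exact tendsto_pi_nhds.2 fun y => T.tendsto_subtree y (T.gridHeight_nonneg · y)
      (T.gridHeight_le · y) (T.tendsto_gridHeight y)

theorem measurable_subtree : Measurable fun p : ℝ × T => (T.subtree p.1 p.2).toTreeSpace :=
  T.measurable_subtreeAbove.comp T.continuous_ancestor.measurable

/-! ### The measure `Ψ_T` -/

/-- The map `(x, r) ↦ (T_{r,x}, r)`. -/
noncomputable def branch (p : T × ℝ) : TreeSpace × ℝ≥0 :=
  ((T.subtree p.2 p.1).toTreeSpace, p.2.toNNReal)

theorem measurable_branch : Measurable T.branch :=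
  (T.measurable_subtree.comp measurable_swap).prodMk (measurable_real_toNNReal.comp measurable_snd)

/-- The pairs `(x, r)` with `0 ≤ r ≤ H(x)`. -/
def belowGraph : Set (T × ℝ) := {p | 0 ≤ p.2 ∧ p.2 ≤ T.height p.1}

theorem isClosed_belowGraph : IsClosed T.belowGraph :=
  (isClosed_le continuous_const continuous_snd).inter
    (isClosed_le continuous_snd (T.continuous_height.comp continuous_fst))

theorem measurableSet_belowGraph : MeasurableSet T.belowGraph := T.isClosed_belowGraph.measurableSet

/-- The measure `Ψ_T`. -/
noncomputable def psiMeasure : Measure (TreeSpace × ℝ≥0) :=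
  ((T.μ.prod volume).restrict T.belowGraph).map T.branch

theorem lintegral_psiMeasure {f : TreeSpace × ℝ≥0 → ℝ≥0∞} (hf : Measurable f) :
    ∫⁻ p, f p ∂T.psiMeasure = ∫⁻ x, (∫⁻ r in Set.Icc (0 : ℝ) (T.height x),
      f ((T.subtree r x).toTreeSpace, r.toNNReal)) ∂T.μ := by
  have hm : Measurable fun p => f (T.branch p) := hf.comp T.measurable_branch
  rw [psiMeasure, lintegral_map hf T.measurable_branch,
    ← lintegral_indicator T.measurableSet_belowGraph,
    lintegral_prod _ (hm.indicator T.measurableSet_belowGraph).aemeasurable]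
  refine lintegral_congr fun x => ?_
  rw [← lintegral_indicator measurableSet_Icc]
  rfl

instance : IsFiniteMeasure T.psiMeasure := by
  obtain ⟨K, hK0, hK⟩ := T.exists_height_le
  refine ⟨?_⟩
  rw [← setLIntegral_one, setLIntegral_univ,
    T.lintegral_psiMeasure (f := fun _ => 1) measurable_const]
  calc _ ≤ ∫⁻ _, ENNReal.ofReal K ∂T.μ := by
        refine lintegral_mono fun x => ?_
        simp only [setLIntegral_one, Real.volume_Icc, sub_zero]
        exact ENNReal.ofReal_le_ofReal (hK x)
    _ < ∞ := by
        rw [lintegral_const]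
        finiteness

/-- The isometry classes of subtrees are transported by isometries. -/
theorem dist_subtree_eq_zero {T T' : WeightedTree} {e : T ≃ᵢ T'} (h : e T.root = T'.root)
    (hμ : T.μ.map e = T'.μ) {r : ℝ} {x : T} (h0 : 0 ≤ r) (h1 : r ≤ T.height x) :
    dist (T.subtree r x).toTreeSpace (T'.subtree r (e x)).toTreeSpace = 0 := by
  have hH : ∀ z, T'.height (e z) = T.height z := fun z => by
    unfold height
    rw [← h, e.dist_eq]
  have hd : dist (T'.ancestor r (e x)) (e (T.ancestor r x)) ≤ 0 := by
    rw [dist_comm]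
    refine T'.dist_ancestor_le h0 (by rwa [hH]) ?_ ?_
    · rw [hH, T.height_ancestor h0 h1, add_zero]
    · rw [hH, e.dist_eq, T.dist_ancestor h0 h1, add_zero]
  have := (Equivalent.isCoupling h hμ).close_subtreeAbove (y := T.ancestor r x)
    (y' := T'.ancestor r (e x)) (N := ∅) MeasurableSet.empty (δ := 0) (by simp) (by simp) ?_
    (w := (T.ancestor r x, e (T.ancestor r x))) rfl (by simp) hd
  · rw [dist_toTreeSpace]
    refine le_antisymm ((closeDist_le this).trans ?_) (closeDist_nonneg _ _)
    norm_num
  · rintro ⟨z, z'⟩ (rfl : e z = z') -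
    rw [T.mem_above_ancestor_iff h0 h1, T'.mem_above_ancestor_iff h0 (by rwa [hH])]
    simp only [gromovProd, hH, e.dist_eq]

/-- Corresponding subtrees are at distance zero, hence topologically inseparable, and a Borel
function takes equal values at inseparable points. -/
theorem psiMeasure_congr {T T' : WeightedTree} (h : Equivalent T T') :
    T.psiMeasure = T'.psiMeasure := by
  obtain ⟨e, h, hμ⟩ := h
  refine Measure.ext_of_lintegral _ fun f hf => ?_
  have hm : Measurable fun y => ∫⁻ r in Set.Icc (0 : ℝ) (T'.height y),
      f ((T'.subtree r y).toTreeSpace, r.toNNReal) := by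
    have h1 : Measurable fun p => T'.belowGraph.indicator (fun p => f (T'.branch p)) p :=
      (hf.comp T'.measurable_branch).indicator T'.measurableSet_belowGraph
    have h2 := h1.lintegral_prod_right' (ν := volume)
    convert h2 using 2 with y
    rw [← lintegral_indicator measurableSet_Icc]
    rfl
  rw [T.lintegral_psiMeasure hf, T'.lintegral_psiMeasure hf, ← hμ,
    lintegral_map hm e.continuous.measurable]
  refine lintegral_congr fun x => ?_
  have hH : T'.height (e x) = T.height x := by
    unfold height
    rw [← h, e.dist_eq]
  rw [hH]
  refine setLIntegral_congr_fun measurableSet_Icc fun r hr => ?_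
  have hsep : Inseparable ((T.subtree r x).toTreeSpace, r.toNNReal)
      ((T'.subtree r (e x)).toTreeSpace, r.toNNReal) :=
    (Metric.inseparable_iff.2 (dist_subtree_eq_zero h hμ hr.1 hr.2)).prod Inseparable.rfl
  exact ((hsep.mem_measurableSet_iff (hf (measurableSet_singleton _))).1 rfl).symm

end WeightedTree

theorem isPsi_iff {Ψ : TreeSpace → FiniteMeasure (TreeSpace × ℝ≥0)} :
    IsPsi Ψ ↔ ∀ T : WeightedTree, (Ψ T.toTreeSpace : Measure (TreeSpace × ℝ≥0)) = T.psiMeasure := by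
  constructor
  · intro h T
    refine Measure.ext_of_lintegral _ fun f hf => ?_
    rw [h T f hf, T.lintegral_psiMeasure hf]
  · intro h T f hf
    rw [h T, T.lintegral_psiMeasure hf]

theorem existsUnique_isPsi :
    ∃! Ψ : TreeSpace → FiniteMeasure (TreeSpace × ℝ≥0), IsPsi Ψ := by
  refine ⟨fun t => ⟨t.out.psiMeasure, inferInstance⟩, isPsi_iff.2 fun T => ?_, fun Ψ hΨ => ?_⟩
  · exact WeightedTree.psiMeasure_congr (equivalent_out T)
  · funext t
    refine Subtype.ext ?_
    have := isPsi_iff.1 hΨ t.out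
    rwa [t.toTreeSpace_out] at this

end RealTrees

/-! ### Bad levels and continuity of Ψ. -/

namespace RealTrees

namespace WeightedTree

variable (T : WeightedTree)

/-- The pairs `(x, r)` for which `r` is `η`-close to the height of `x`, or for which many points
branch off the ancestral line of `x` at a level that is `2η`-close to `r`. -/
def badSet (h η : ℝ) : Set (T × ℝ) :=
  {p | |p.2 - T.height p.1| ≤ η} ∪
    ({p | ENNReal.ofReal h < T.μ {z | |T.gromovProd p.1 z - p.2| ≤ 2 * η}} ∪
      {p | ∃ z, |T.gromovProd p.1 z - p.2| ≤ 2 * η ∧ h ≤ dist z (T.ancestor p.2 p.1)})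

/-- The existential condition is a projection of a closed set along the compact tree, which is why
its inequalities are weak. -/
theorem measurableSet_badSet (h η : ℝ) : MeasurableSet (T.badSet h η) := by
  have hg : Continuous fun q : (T × ℝ) × T => |T.gromovProd q.1.1 q.2 - q.1.2| :=
    ((T.continuous_gromovProd.comp (by fun_prop : Continuous fun q : (T × ℝ) × T =>
      (q.1.1, q.2))).sub (by fun_prop)).abs
  have hc : IsClosed {q : (T × ℝ) × T | |T.gromovProd q.1.1 q.2 - q.1.2| ≤ 2 * η} :=
    isClosed_le hg continuous_const
  refine MeasurableSet.union ?_ (MeasurableSet.union ?_ ?_)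
  · refine (isClosed_le ?_ continuous_const).measurableSet
    exact (continuous_snd.sub (T.continuous_height.comp continuous_fst)).abs
  · exact measurableSet_lt measurable_const (measurable_measure_prodMk_left hc.measurableSet)
  · have hd : Continuous fun q : (T × ℝ) × T => dist q.2 (T.ancestor q.1.2 q.1.1) :=
      continuous_snd.dist (T.continuous_ancestor.comp (by fun_prop :
        Continuous fun q : (T × ℝ) × T => (q.1.2, q.1.1)))
    have := isClosedMap_fst_of_compactSpace _ (hc.inter (isClosed_le continuous_const hd
      (f := fun _ => h)))
    convert this.measurableSet
    ext p
    constructor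
    · rintro ⟨z, hz⟩
      exact ⟨(p, z), hz, rfl⟩
    · rintro ⟨⟨q, z⟩, hz, rfl⟩
      exact ⟨z, hz⟩

theorem badSet_mono (h : ℝ) {η δ : ℝ} (hle : η ≤ δ) : T.badSet h η ⊆ T.badSet h δ := by
  rintro p (hp | hp | ⟨z, hz, hz'⟩)
  · exact Or.inl (le_trans hp hle)
  · have hsub : {z | |T.gromovProd p.1 z - p.2| ≤ 2 * η} ⊆
        {z | |T.gromovProd p.1 z - p.2| ≤ 2 * δ} := 
      fun z (hz : |T.gromovProd p.1 z - p.2| ≤ 2 * η) => hz.trans (by linarith)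
    exact Or.inr (Or.inl (lt_of_lt_of_le (b := T.μ _) hp (measure_mono hsub)))
  · exact Or.inr (Or.inr ⟨z, hz.trans (by linarith), hz'⟩)

/-- For each `x`, only countably many levels are bad at all scales. -/
theorem countable_iInter_badSet {h : ℝ} (hh : 0 < h) (x : T) :
    {r : ℝ | ∀ n : ℕ, (x, r) ∈ T.badSet h (1 / (n + 1))}.Countable := by
  have hc := T.continuous_gromovProd_right x
  -- Besides H(x), the exceptional levels are the atoms of the image of μ under (x|·) and the levels
  -- of branches reaching distance `h`.
  refine (((Set.countable_singleton (T.height x)).union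
    (Measure.countable_meas_level_set_pos (μ := T.μ) hc.measurable)).union
      (T.countable_branching x hh)).mono fun r hr => ?_
  by_contra hcon
  rw [Set.mem_union, Set.mem_union, not_or, not_or] at hcon
  obtain ⟨⟨h1, h2⟩, h3⟩ := hcon
  let N : ℕ → Set T := fun n => {z | |T.gromovProd x z - r| ≤ 2 * (1 / ((n : ℝ) + 1))}
  have hNc : ∀ n, IsClosed (N n) := fun n => isClosed_le (hc.sub continuous_const).abs
    continuous_const
  have hNanti : Antitone N := by
    intro j k hjk z (hz : |T.gromovProd x z - r| ≤ 2 * (1 / ((k : ℝ) + 1)))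
    have := Nat.one_div_le_one_div (α := ℝ) hjk
    exact hz.trans (by linarith)
  have hlim : Filter.Tendsto (fun n : ℕ => 2 * (1 / ((n : ℝ) + 1))) Filter.atTop (nhds 0) := by
    simpa using (tendsto_one_div_add_atTop_nhds_zero_nat (𝕜 := ℝ)).const_mul 2
  have hNinter : ⋂ n, N n = {z | T.gromovProd x z = r} := by
    ext z
    rw [Set.mem_iInter]
    constructor
    · intro hz
      have := ge_of_tendsto' hlim hz
      exact sub_eq_zero.1 (abs_eq_zero.1 (le_antisymm this (abs_nonneg _)))
    · rintro (hz : _ = _) n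
      change |T.gromovProd x z - r| ≤ 2 * (1 / ((n : ℝ) + 1))
      rw [hz, sub_self, abs_zero]
      positivity
  have e1 : ∀ᶠ n : ℕ in Filter.atTop, 2 * (1 / ((n : ℝ) + 1)) < |r - T.height x| :=
    hlim.eventually (gt_mem_nhds (abs_pos.2 (sub_ne_zero.2 h1)))
  have e2 : ∀ᶠ n : ℕ in Filter.atTop, T.μ (N n) < ENNReal.ofReal h := by
    have := tendsto_measure_iInter_atTop (μ := T.μ)
      (fun k => (hNc k).measurableSet.nullMeasurableSet) hNanti ⟨0, measure_ne_top _ _⟩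
    have h2' : T.μ {z | T.gromovProd x z = r} = 0 := nonpos_iff_eq_zero.1 (not_lt.1 h2)
    rw [hNinter, h2'] at this
    exact this.eventually (gt_mem_nhds (ENNReal.ofReal_pos.2 hh))
  -- Otherwise the decreasing nonempty compact sets `C n` have a common point, which branches off
  -- exactly at level `r` and is far from x_r.
  have e3 : ∀ᶠ n : ℕ in Filter.atTop, ∀ z ∈ N n, dist z (T.ancestor r x) < h := by
    let C : ℕ → Set T := fun n => N n ∩ {z | h ≤ dist z (T.ancestor r x)}
    have hCc : ∀ n, IsClosed (C n) := fun n =>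
      (hNc n).inter (isClosed_le continuous_const (continuous_id.dist continuous_const))
    by_contra hcon
    have hne : ∀ n, (C n).Nonempty := by
      intro n
      by_contra hn
      refine hcon (Filter.eventually_atTop.2 ⟨n, fun k hk z hz => ?_⟩)
      by_contra hz'
      exact hn ⟨z, hNanti hk hz, not_lt.1 hz'⟩
    obtain ⟨z, hz⟩ := IsCompact.nonempty_iInter_of_sequence_nonempty_isCompact_isClosed C
      (fun n => Set.inter_subset_inter_left _ (hNanti n.le_succ)) hne (hCc 0).isCompact hCc
    rw [Set.mem_iInter] at hz
    have hz1 : z ∈ ⋂ n, N n := Set.mem_iInter.2 fun n => (hz n).1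
    rw [hNinter] at hz1
    exact h3 ⟨z, hz1, (hz 0).2⟩
  obtain ⟨n, k1, k2, k3⟩ := (e1.and (e2.and e3)).exists
  rcases hr n with hb | hb | ⟨z, hz, hz'⟩
  · have hb' : |r - T.height x| ≤ 1 / ((n : ℝ) + 1) := hb
    have : 0 < 1 / ((n : ℝ) + 1) := Nat.one_div_pos_of_nat
    linarith
  · exact lt_asymm k2 hb
  · exact (k3 z hz).not_ge hz'

/-- Countable sections are Lebesgue null, so by Fubini the intersection over scales is null; the
bounded window makes the measure finite, as continuity from above requires. -/
theorem exists_badSet_le {h κ : ℝ} (hh : 0 < h) (hκ : 0 < κ) (K : ℝ) :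
    ∃ η > 0, (T.μ.prod (volume.restrict (Set.Icc 0 K))).real (T.badSet h η) ≤ κ := by
  have hm : ∀ n : ℕ, MeasurableSet (T.badSet h (1 / ((n : ℝ) + 1))) := fun n =>
    T.measurableSet_badSet h _
  have hlim := tendsto_measure_iInter_atTop (μ := T.μ.prod (volume.restrict (Set.Icc 0 K)))
    (fun n => (hm n).nullMeasurableSet)
    (fun j k hjk => T.badSet_mono h (Nat.one_div_le_one_div hjk)) ⟨0, measure_ne_top _ _⟩
  have hzero : (T.μ.prod (volume.restrict (Set.Icc 0 K)))
      (⋂ n : ℕ, T.badSet h (1 / ((n : ℝ) + 1))) = 0 := by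
    rw [Measure.measure_prod_null (MeasurableSet.iInter hm)]
    refine Filter.Eventually.of_forall fun x => ?_
    refine (Set.Countable.mono ?_ (T.countable_iInter_badSet hh x)).measure_zero _
    exact fun r hr n => Set.mem_iInter.1 hr n
  rw [hzero] at hlim
  obtain ⟨n, hn⟩ := (hlim.eventually (gt_mem_nhds (ENNReal.ofReal_pos.2 hκ))).exists
  exact ⟨1 / ((n : ℝ) + 1), Nat.one_div_pos_of_nat, ENNReal.toReal_le_of_le_ofReal hκ.le hn.le⟩

/-- A window [0, K] independent of `x` lets two trees be compared against the same Lebesgue factor.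
-/
theorem integral_psiMeasure {f : TreeSpace × ℝ≥0 → ℝ} (hf : Measurable f) {K : ℝ}
    (hK : ∀ x, T.height x ≤ K) :
    ∫ p, f p ∂T.psiMeasure = ∫ p, T.belowGraph.indicator (f ∘ T.branch) p
      ∂(T.μ.prod (volume.restrict (Set.Icc 0 K))) := by
  have e : T.μ.prod (volume.restrict (Set.Icc 0 K)) =
      (T.μ.prod volume).restrict (Set.univ ×ˢ Set.Icc 0 K) := by
    rw [← Measure.prod_restrict, Measure.restrict_univ]
  have hsub : T.belowGraph ∩ Set.univ ×ˢ Set.Icc 0 K = T.belowGraph :=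
    Set.inter_eq_left.2 fun p hp => ⟨trivial, hp.1, hp.2.trans (hK _)⟩
  rw [psiMeasure, integral_map T.measurable_branch.aemeasurable hf.aestronglyMeasurable,
    integral_indicator T.measurableSet_belowGraph, e,
    Measure.restrict_restrict T.measurableSet_belowGraph, hsub]
  rfl

end WeightedTree

theorem abs_indicator_le {X : Type*} {s : Set X} {f : X → ℝ} {M : ℝ} (hf : ∀ x, |f x| ≤ M) (x : X) :
    |s.indicator f x| ≤ M :=
  (norm_indicator_le_norm_self f x).trans (hf x)

/-- Replacing each measure by the marginal of `m` costs M K η. Under `m`, the integrands differ by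
at most 2M on the bad set, and elsewhere by the Lipschitz constant times the bound of
`close_subtree`. -/
theorem IsCoupling.abs_integral_psiMeasure_sub_le {T T' : WeightedTree} {R : Set (T × T')}
    {m : Measure (T × T')} {η : ℝ} (hc : IsCoupling R m η) {f : TreeSpace × ℝ≥0 → ℝ}
    (hf : Measurable f) {M : ℝ} (hM : ∀ p, |f p| ≤ M) {L : ℝ≥0} (hL : LipschitzWith L f)
    {K h : ℝ} (hK0 : 0 ≤ K) (hK : ∀ x, T.height x ≤ K) (hK' : ∀ x, T'.height x ≤ K) (hh : 0 ≤ h) :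
    |(∫ p, f p ∂T.psiMeasure) - ∫ p, f p ∂T'.psiMeasure| ≤
      2 * M * K * η + L * (17 * η + 8 * h) * K * T.μ.real Set.univ +
        2 * M * (T.μ.prod (volume.restrict (Set.Icc 0 K))).real (T.badSet h η) := by
  have := hc.isFiniteMeasure
  have hη := hc.nonneg
  have hM0 : 0 ≤ M := (abs_nonneg _).trans (hM (T.toTreeSpace, 0))
  rw [T.integral_psiMeasure hf hK, T'.integral_psiMeasure hf hK']
  set ν : Measure ℝ := volume.restrict (Set.Icc 0 K)
  have hν : ν.real Set.univ = K := by
    rw [measureReal_restrict_apply_univ, Real.volume_real_Icc_of_le hK0, sub_zero]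
  set G := T.belowGraph.indicator (f ∘ T.branch)
  set G' := T'.belowGraph.indicator (f ∘ T'.branch)
  have hG : Measurable G := (hf.comp T.measurable_branch).indicator T.measurableSet_belowGraph
  have hG' : Measurable G' := (hf.comp T'.measurable_branch).indicator T'.measurableSet_belowGraph
  have hGM : ∀ p, |G p| ≤ M := abs_indicator_le fun p => hM _
  have hGM' : ∀ p, |G' p| ≤ M := abs_indicator_le fun p => hM _
  have m1 : Measurable fun q : (T × T') × ℝ => (q.1.1, q.2) := by fun_prop
  have m2 : Measurable fun q : (T × T') × ℝ => (q.1.2, q.2) := by fun_prop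
  have e1 : (m.map Prod.fst).prod ν = (m.prod ν).map fun q => (q.1.1, q.2) := by
    conv_lhs => rw [← Measure.map_id (μ := ν)]
    exact Measure.map_prod_map _ _ measurable_fst measurable_id
  have e2 : (m.map Prod.snd).prod ν = (m.prod ν).map fun q => (q.1.2, q.2) := by
    conv_lhs => rw [← Measure.map_id (μ := ν)]
    exact Measure.map_prod_map _ _ measurable_snd measurable_id
  have hmass : ∀ {X : Type} [MeasurableSpace X] (μ : Measure X) [IsFiniteMeasure μ],
      (μ.prod ν).real Set.univ = μ.real Set.univ * K := fun μ _ => by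
    rw [← Set.univ_prod_univ, measureReal_prod_prod, hν]
  have a1 := abs_integral_sub_le_of_le (Measure.prod_mono hc.map_fst_le (le_refl ν)) hG hGM
  have a2 := abs_integral_sub_le_of_le (Measure.prod_mono hc.map_snd_le (le_refl ν)) hG' hGM'
  rw [hmass, hmass, measureReal_map_univ _ measurable_fst, e1,
    integral_map m1.aemeasurable hG.aestronglyMeasurable] at a1
  rw [hmass, hmass, measureReal_map_univ _ measurable_snd, e2,
    integral_map m2.aemeasurable hG'.aestronglyMeasurable] at a2
  have b1 : M * (T.μ.real Set.univ * K - m.real Set.univ * K) ≤ M * (η * K) := by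
    rw [← sub_mul]
    gcongr
    linarith [hc.mass_left]
  have b2 : M * (T'.μ.real Set.univ * K - m.real Set.univ * K) ≤ M * (η * K) := by
    rw [← sub_mul]
    gcongr
    linarith [hc.mass_right]
  have hbad := T.measurableSet_badSet h η
  set c : ℝ := L * (17 * η + 8 * h)
  have hc0 : 0 ≤ c := by positivity
  have hi : Integrable (fun q : (T × T') × ℝ => G (q.1.1, q.2)) (m.prod ν) :=
    integrable_of_abs_le _ (hG.comp m1) fun q => hGM _
  have hi' : Integrable (fun q : (T × T') × ℝ => G' (q.1.2, q.2)) (m.prod ν) :=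
    integrable_of_abs_le _ (hG'.comp m2) fun q => hGM' _
  have hib : Integrable (fun q : (T × T') × ℝ => (T.badSet h η).indicator (fun _ => 2 * M)
      (q.1.1, q.2)) (m.prod ν) :=
    integrable_of_abs_le (M := 2 * M) _ ((measurable_const.indicator hbad).comp m1)
      fun q => abs_indicator_le (fun _ => (abs_of_nonneg (by positivity)).le) _
  have hR : ∀ᵐ q ∂(m.prod ν), q.1 ∈ R := Measure.quasiMeasurePreserving_fst.ae hc.null
  have a3 : |(∫ q, G (q.1.1, q.2) ∂(m.prod ν)) - ∫ q, G' (q.1.2, q.2) ∂(m.prod ν)| ≤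
      ∫ q, (c + (T.badSet h η).indicator (fun _ => 2 * M) (q.1.1, q.2)) ∂(m.prod ν) := by
    rw [← integral_sub hi hi']
    refine (Real.norm_eq_abs _).symm.le.trans
      (norm_integral_le_of_norm_le ((integrable_const c).add hib) ?_)
    filter_upwards [hR] with q hq
    obtain ⟨⟨x, x'⟩, r⟩ := q
    have hxx := abs_le.1 (hc.abs_height_sub_le hq)
    rw [Real.norm_eq_abs]
    dsimp only
    by_cases hqb : (x, r) ∈ T.badSet h η
    · rw [Set.indicator_of_mem hqb]
      have k1 := abs_le.1 (hGM (x, r))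
      have k2 := abs_le.1 (hGM' (x', r))
      rw [abs_le]
      constructor <;> linarith
    · rw [Set.indicator_of_notMem hqb, add_zero]
      simp only [WeightedTree.badSet, Set.mem_union, not_or] at hqb
      obtain ⟨k1, k2, k3⟩ := hqb
      -- As H(x) and H'(x') differ by at most η, the level `r` lies on the same side of both, so the
      -- two indicators agree.
      have k1' : η < |r - T.height x| := not_le.1 k1
      by_cases hb : (x, r) ∈ T.belowGraph
      · have hlt : r < T.height x - η := by
          rcases lt_abs.1 k1' with hl | hl
          · have : r ≤ T.height x := hb.2
            linarith
          · linarith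
        have hb' : (x', r) ∈ T'.belowGraph := ⟨hb.1, by dsimp only; linarith⟩
        simp only [G, G']
        rw [Set.indicator_of_mem hb, Set.indicator_of_mem hb']
        have hcl := hc.close_subtree hq hb.1 hb.2 hb'.2
          (ENNReal.toReal_le_of_le_ofReal hh (not_lt.1 k2))
          fun z hz => (not_le.1 fun hle => k3 ⟨z, hz, hle⟩).le
        refine (hL.dist_le_mul _ _).trans ?_
        refine mul_le_mul_of_nonneg_left ?_ L.2
        refine max_le ?_ ?_
        · exact (dist_toTreeSpace _ _).le.trans (closeDist_le hcl)
        · change dist r.toNNReal r.toNNReal ≤ _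
          rw [dist_self]
          positivity
      · have hb' : (x', r) ∉ T'.belowGraph := by
          rintro ⟨h1, h2⟩
          dsimp only at h1 h2
          refine hb ⟨h1, ?_⟩
          dsimp only
          rcases lt_abs.1 k1' with hl | hl <;> linarith
        simp only [G, G']
        rw [Set.indicator_of_notMem hb, Set.indicator_of_notMem hb', sub_zero, abs_zero]
        exact hc0
  have a4 : ∫ q, (c + (T.badSet h η).indicator (fun _ => 2 * M) (q.1.1, q.2)) ∂(m.prod ν) ≤
      c * K * T.μ.real Set.univ + 2 * M * (T.μ.prod ν).real (T.badSet h η) := by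
    rw [integral_add (integrable_const c) hib, integral_const, hmass, smul_eq_mul]
    have i1 : ∫ q, (T.badSet h η).indicator (fun _ => 2 * M) (q.1.1, q.2) ∂(m.prod ν) =
        ((m.map Prod.fst).prod ν).real (T.badSet h η) * (2 * M) := by
      rw [e1, ← integral_map m1.aemeasurable
        (measurable_const.indicator hbad).aestronglyMeasurable, integral_indicator hbad,
        setIntegral_const, smul_eq_mul]
    have i2 : ((m.map Prod.fst).prod ν).real (T.badSet h η) ≤
        (T.μ.prod ν).real (T.badSet h η) :=
      ENNReal.toReal_mono (measure_ne_top _ _) (Measure.prod_mono hc.map_fst_le (le_refl ν) _)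
    have i3 : m.real Set.univ ≤ T.μ.real Set.univ := by
      simpa using hc.measureReal_fst_le MeasurableSet.univ
    rw [i1]
    have j1 := mul_le_mul_of_nonneg_right i2 (by positivity : 0 ≤ 2 * M)
    have j2 := mul_le_mul_of_nonneg_right i3 (mul_nonneg hK0 hc0)
    linarith
  rw [abs_le] at *
  constructor <;> linarith [a1.1, a1.2, a2.1, a2.2, a3.1, a3.2]

theorem tendsto_integral_psi {Ψ : TreeSpace → FiniteMeasure (TreeSpace × ℝ≥0)} (hΨ : IsPsi Ψ)
    {f : TreeSpace × ℝ≥0 → ℝ} {M : ℝ} (hM : ∀ p, |f p| ≤ M) {L : ℝ≥0} (hL : LipschitzWith L f)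
    (t : TreeSpace) :
    Filter.Tendsto (fun t' => ∫ p, f p ∂(Ψ t' : Measure (TreeSpace × ℝ≥0))) (nhds t)
      (nhds (∫ p, f p ∂(Ψ t : Measure (TreeSpace × ℝ≥0)))) := by
  have hf : Measurable f := hL.continuous.measurable
  have hout : ∀ t, (Ψ t : Measure (TreeSpace × ℝ≥0)) = t.out.psiMeasure := fun t => by
    have := isPsi_iff.1 hΨ t.out
    rwa [t.toTreeSpace_out] at this
  simp only [hout]
  set T := t.out with hT
  obtain ⟨K, hK0, hK⟩ := T.exists_height_le
  have hM0 : 0 ≤ M := (abs_nonneg _).trans (hM (t, 0))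
  refine Metric.tendsto_nhds_nhds.2 fun ε hε => ?_
  set μ := T.μ.real Set.univ
  have hμ : 0 ≤ μ := measureReal_nonneg
  -- `A`, `B` and `C` bound the coefficients of the scale, of `h` and of the bad mass, with 1 added
  -- for positivity; each term is allotted ε/4. The bound K + 1 also covers the heights of nearby
  -- trees.
  set A : ℝ := 2 * M * (K + 1) + L * 17 * (K + 1) * μ + 1
  set B : ℝ := L * 8 * (K + 1) * μ + 1
  set C : ℝ := 2 * M + 1
  have hA : 0 < A := by positivity
  have hB : 0 < B := by positivity
  have hC : 0 < C := by positivity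
  obtain ⟨η, hη, hbad⟩ := T.exists_badSet_le (h := ε / (4 * B)) (κ := ε / (4 * C))
    (by positivity) (by positivity) (K + 1)
  refine ⟨min (min η 1) (ε / (4 * A)), by positivity, fun {t'} ht' => ?_⟩
  rw [dist_comm] at ht' ⊢
  obtain ⟨δ, hδ, R, m, hc⟩ := exists_close_lt (T := T) (T' := t'.out) ht'
  have hδη : δ ≤ η := (hδ.trans_le ((min_le_left _ _).trans (min_le_left _ _))).le
  have hδ1 : δ ≤ 1 := (hδ.trans_le ((min_le_left _ _).trans (min_le_right _ _))).le
  have hδA : δ < ε / (4 * A) := hδ.trans_le (min_le_right _ _)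
  have hK' : ∀ x, t'.out.height x ≤ K + 1 := by
    intro x'
    obtain ⟨x, hx⟩ := hc.exists_left x'
    have := (abs_le.1 (hc.abs_height_sub_le hx)).1
    linarith [hK x]
  have key := hc.abs_integral_psiMeasure_sub_le hf hM hL (h := ε / (4 * B)) (K := K + 1)
    (by positivity) (fun x => (hK x).trans (by linarith)) hK' (by positivity)
  have hbad' := (measureReal_mono (μ := T.μ.prod (volume.restrict (Set.Icc 0 (K + 1))))
    (T.badSet_mono (ε / (4 * B)) hδη)).trans hbad
  have b1 : A * δ ≤ ε / 4 := by
    calc A * δ ≤ A * (ε / (4 * A)) := by gcongr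
      _ = ε / 4 := by field_simp
  have b2 : B * (ε / (4 * B)) = ε / 4 := by field_simp
  have b3 : C * (ε / (4 * C)) = ε / 4 := by field_simp
  have hδ0 := hc.nonneg
  have hh0 : 0 < ε / (4 * B) := by positivity
  have hk0 : 0 < ε / (4 * C) := by positivity
  have b4 := mul_le_mul_of_nonneg_left hbad' (by positivity : 0 ≤ 2 * M)
  rw [Real.dist_eq]
  refine key.trans_lt ?_
  simp only [A, B, C] at b1 b2 b3 b4 hh0 hk0 ⊢
  linarith

/-- Bounded Lipschitz functions determine weak convergence of probability measures, so the measures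
are normalized and their masses, the case f = 1, treated apart. A zero limit cannot be normalized;
there convergence of the masses suffices. -/
theorem continuous_of_isPsi {Ψ : TreeSpace → FiniteMeasure (TreeSpace × ℝ≥0)} (hΨ : IsPsi Ψ) :
    Continuous Ψ := by
  refine continuous_iff_continuousAt.2 fun t => ?_
  have : Nonempty (TreeSpace × ℝ≥0) := ⟨(t, 0)⟩
  have hreal : Filter.Tendsto (fun t' => ((Ψ t').mass : ℝ)) (nhds t) (nhds (Ψ t).mass) := by
    have := tendsto_integral_psi hΨ (f := fun _ => 1) (M := 1) (by simp)
      (LipschitzWith.const 1) t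
    simp only [integral_const, smul_eq_mul, mul_one] at this
    exact this
  have hmass : Filter.Tendsto (fun t' => (Ψ t').mass) (nhds t) (nhds (Ψ t).mass) :=
    NNReal.tendsto_coe.1 hreal
  by_cases h0 : Ψ t = 0
  · unfold ContinuousAt
    rw [h0] at hmass ⊢
    exact FiniteMeasure.tendsto_zero_of_tendsto_zero_mass (by simpa using hmass)
  · have hm0 : (Ψ t).mass ≠ 0 := (FiniteMeasure.mass_nonzero_iff _).2 h0
    refine FiniteMeasure.tendsto_of_tendsto_normalize_testAgainstNN_of_tendsto_mass ?_ hmass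
    refine tendsto_iff_forall_lipschitz_integral_tendsto.2 ?_
    rintro f ⟨c, hc⟩ ⟨L, hL⟩
    have hM : ∀ p, |f p| ≤ |f (t, 0)| + c := by
      intro p
      have h1 := hc p (t, 0)
      rw [Real.dist_eq] at h1
      have h2 := abs_sub_abs_le_abs_sub (f p) (f (t, 0))
      linarith
    have hav : ∀ t', Ψ t' ≠ 0 → ∫ p, f p ∂((Ψ t').normalize : Measure (TreeSpace × ℝ≥0)) =
        ((Ψ t').mass : ℝ)⁻¹ * ∫ p, f p ∂(Ψ t' : Measure (TreeSpace × ℝ≥0)) := by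
      intro t' ht'
      rw [← FiniteMeasure.average_eq_integral_normalize _ ht', average_eq, smul_eq_mul]
      rfl
    have hne : ∀ᶠ t' in nhds t, Ψ t' ≠ 0 := by
      filter_upwards [hmass.eventually_ne hm0] with t' ht'
      exact (FiniteMeasure.mass_nonzero_iff _).1 ht'
    rw [hav t h0]
    refine Filter.Tendsto.congr' (hne.mono fun t' ht' => (hav t' ht').symm) ?_
    exact (hreal.inv₀ (by exact_mod_cast hm0)).mul (tendsto_integral_psi hΨ hM hL t)

end RealTrees

theorem theorem1p2 :
    (∀ T : RealTrees.WeightedTree,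
      Measurable (fun p : {p : ℝ≥0 × T // (p.1 : ℝ) ≤ T.height p.2} =>
        (T.subtree p.1.1 p.1.2).toTreeSpace)) ∧
    (∃! Ψ : RealTrees.TreeSpace → FiniteMeasure (RealTrees.TreeSpace × ℝ≥0), RealTrees.IsPsi Ψ) ∧
    (∀ Ψ : RealTrees.TreeSpace → FiniteMeasure (RealTrees.TreeSpace × ℝ≥0),
      RealTrees.IsPsi Ψ → Continuous Ψ) := by
  refine ⟨fun T => ?_, RealTrees.existsUnique_isPsi, fun Ψ hΨ => RealTrees.continuous_of_isPsi hΨ⟩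
  have h1 : Measurable fun p : {p : ℝ≥0 × T // (p.1 : ℝ) ≤ T.height p.2} => (p.1.1 : ℝ) :=
    measurable_coe_nnreal_real.comp (measurable_fst.comp measurable_subtype_coe)
  have h2 : Measurable fun p : {p : ℝ≥0 × T // (p.1 : ℝ) ≤ T.height p.2} => p.1.2 :=
    measurable_snd.comp measurable_subtype_coe
  have h3 := T.measurable_subtree.comp (h1.prodMk h2)
  exact h3
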